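/- Let $d,n$ be positive integers, let $K$ be a number field of degree $k=[K:\mathbb{Q}]$ with ring of integers $\mathfrak{o}$ and discriminant $\Delta_K$, and let $\mathbb{E}=\{e_1,\dots,e_k\}$ be an integral basis of $\mathfrak{o}$. Let $\mathcal{P}_K$ be the set of non-zero prime ideals of $\mathfrak{o}$ and $N_K=\mathcal{P}_K\cup\{\infty\}$. For $\mathfrak{p}\in\mathcal{P}_K$ above the rational prime $p$ and $x\in[-\infty,\infty]$ write $\mathfrak{p}\succ x$ if $p>x$ and $\mathfrak{p}\preceq x$ if $p\le x$. Let $\mathfrak{o}_\mathfrak{p}$ be the completion of $\mathfrak{o}$ at $\mathfrak{p}$, and $\nu_\mathfrak{p}$ the normalized Haar measure on $\mathfrak{o}_\mathfrak{p}^d$. Let $k_\infty=\mathfrak{o}\otimes_{\mathbb{Z}}\mathbb{R}\cong\mathbb{R}^{r_1}\times\mathbb{C}^{r_2}$, and let $\nu_\infty$ be the Haar measure on $k_\infty$ for which the lattice $\mathfrak{o}$ has covolume $1$, that is, $2^{r_2}|\Delta_K|^{-1/2}$ times Lebesgue measure; write $\nu_\infty$ also for the product measure on $k_\infty^d$. For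 $H\in\mathbb{N}$ put $$O(H,\mathbb{E})=\Big\{\sum_{j=1}^k a_je_j : a_j\in[-H,H[\,\cap\,\mathbb{Z}\Big\},\qquad \overline{\rho}_\mathbb{E}(T)=\limsup_{H\to\infty}\frac{|T\cap O(H,\mathbb{E})^d|}{(2H)^{dk}}\quad(T\subseteq\mathfrak{o}^d).$$ For each $\mathfrak{p}\in\mathcal{P}_K$ let $U_\mathfrak{p}\subseteq\mathfrak{o}_\mathfrak{p}^d$ satisfy $\nu_\mathfrak{p}(\partial U_\mathfrak{p})=0$, and put $s_\mathfrak{p}=\nu_\mathfrak{p}(U_\mathfrak{p})$. Let $U_\infty\subseteq k_\infty^d$ satisfy $\nu_\infty(\partial U_\infty)=0$ and $\mathbb{R}_{\ge0}\cdot U_\infty=U_\infty$, and put $$s_\infty=\frac1{2^{dk}}\,\nu_\infty\Big(U_\infty\cap\Big\{\sum_{j=1}^k a_je_j : a_j\in[-1,1]\Big\}^d\Big).$$ Elements of $\mathfrak{o}^d$ are regarded as elements of $\mathfrak{o}_\mathfrak{p}^d$ and of $k_\infty^d$. Let $I$ be the set of all $A\in\mathfrak{o}^d$ with $A\in U_\eta$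 for infinitely many $\eta\in N_K$, and put $O(H,\mathbb{E})^d_I=O(H,\mathbb{E})^d\setminus I$. Assume: 1. $\displaystyle\lim_{M\to\infty}\overline{\rho}_\mathbb{E}\big(\{A\in\mathfrak{o}^d : A\in U_\mathfrak{p}\text{ for some }\mathfrak{p}\in\mathcal{P}_K,\ \mathfrak{p}\succ M\}\big)=0$. 2. There are $\alpha\in[0,\infty]$ and $c',c\in\mathbb{Z}$ (with the conventions $H^\infty=\infty$ and $0\cdot\infty=0$) such that for all integers $H\ge1$ and all $A\in O(H,\mathbb{E})_I^d$ $$\big|\{\mathfrak{p}\in\mathcal{P}_K : \mathfrak{p}\succ c'H^\alpha,\ A\in U_\mathfrak{p}\}\big|<c .$$ 3. With the same $\alpha$ and $c'$, there is a family of real numbers $(v_\mathfrak{p})_{\mathfrak{p}\in\mathcal{P}_K}$ such that $\sum_{\mathfrak{p}\in\mathcal{P}_K} v_\mathfrak{p}$ converges (unconditionally) and, for all integers $H\ge1$ and all $\mathfrak{p}_1,\dots,\mathfrak{p}_n\preceq c'H^\alpha$, $$\Big|\bigcap_{j=1}^nU_{\mathfrak{p}_j}\cap O(H,\mathbb{E})^d_I\Big|\le(2H)^{kd}\prod_{j=1}^nv_{\mathfrak{p}_j}.$$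 Then the $n$-th moment $$\mu_{n,\mathbb{E}}=\lim_{H\to\infty}\frac{\sum_{A\in O(H,\mathbb{E})_I^d}|\{\eta\in N_K : A\in U_\eta\}|^n}{(2H)^{kd}}$$ exists and is finite, and $$\mu_{n,\mathbb{E}}=\sum_{\substack{\tau\in\mathbb{N}^n\\ \sum_{j=1}^n j\tau_j=n}}c(\tau)\sum_{\substack{\eta_1,\dots,\eta_{\ell(\tau)}\in N_K\\ \text{pairwise distinct}}}\ \prod_{m=1}^{\ell(\tau)}s_{\eta_m},$$ where all inner series converge, $\tau$ has non-negative integer entries, $\ell(\tau)=\sum_{j=1}^n\tau_j$, and $c(\tau)$ is the number of partitions of $\{1,\dots,n\}$ with exactly $\tau_j$ blocks of cardinality $j$ for every $j$. -/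

import Mathlib

open NumberField IsDedekindDomain MeasureTheory Filter Topology
open scoped Valued Pointwise ENNReal

noncomputable section

namespace LocalToGlobal

theorem exists_algebraMap_sub_lt_one {K : Type*} [Field K] [NumberField K]
    (v : HeightOneSpectrum (𝓞 K)) (x : v.adicCompletion K) (hx : Valued.v x ≤ 1) :
    ∃ a : 𝓞 K, Valued.v (algebraMap (𝓞 K) (v.adicCompletion K) a - x) < 1 := by
  have hopen : IsOpen {y : v.adicCompletion K | Valued.v (y - x) < 1} := by
    have h1 : IsOpen {y : v.adicCompletion K | Valued.v y < 1} := by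
      simpa [Valuation.restrict_lt_one_iff] using Valued.isOpen_ball (v.adicCompletion K) 1
    exact h1.preimage (continuous_id.sub continuous_const)
  obtain ⟨k, hk⟩ := (HeightOneSpectrum.denseRange_algebraMap K v).exists_mem_open hopen
    ⟨x, by simp⟩
  have hk1 : v.valuation K k ≤ 1 := by
    rw [← HeightOneSpectrum.valuedAdicCompletion_eq_valuation']
    have : (algebraMap K (v.adicCompletion K) k) = (algebraMap K (v.adicCompletion K) k - x) + x := by
      ring
    change Valued.v (algebraMap K (v.adicCompletion K) k) ≤ 1
    rw [this]
    exact (Valuation.map_add _ _ _).trans (max_le hk.le hx)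
  obtain ⟨a, ha⟩ := v.exists_valuation_sub_lt_of_integer hk1 1
  refine ⟨a, ?_⟩
  have h2 : algebraMap (𝓞 K) (v.adicCompletion K) a - x =
      algebraMap K (v.adicCompletion K) (algebraMap (𝓞 K) K a - k) +
        (algebraMap K (v.adicCompletion K) k - x) := by
    rw [map_sub, ← IsScalarTower.algebraMap_apply]; ring
  rw [h2]
  refine (Valuation.map_add _ _ _).trans_lt (max_lt ?_ hk)
  have := HeightOneSpectrum.valuedAdicCompletion_eq_valuation' v (algebraMap (𝓞 K) K a - k)
  change Valued.v (algebraMap K (v.adicCompletion K) _) = _ at this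
  exact lt_of_eq_of_lt this (by simpa using ha)

theorem finite_residueField_adicCompletion (K : Type*) [Field K] [NumberField K]
    (v : HeightOneSpectrum (𝓞 K)) : Finite 𝓀[v.adicCompletion K] := by
  have : Finite (𝓞 K ⧸ v.asIdeal) := Ideal.finiteQuotientOfFreeOfNeBot _ v.ne_bot
  let f : 𝓞 K →+* 𝓀[v.adicCompletion K] :=
    (IsLocalRing.residue 𝒪[v.adicCompletion K]).comp
      (algebraMap (𝓞 K) (v.adicCompletionIntegers K))
  have hf : ∀ a ∈ v.asIdeal, f a = 0 := by
    intro a ha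
    refine (IsLocalRing.residue_eq_zero_iff _).2 ?_
    refine Valuation.Integer.not_isUnit_iff_valuation_lt_one.2 ?_
    change Valued.v (algebraMap (𝓞 K) (v.adicCompletion K) a) < 1
    have := HeightOneSpectrum.valuedAdicCompletion_eq_valuation v a (K := K)
    change Valued.v (algebraMap (𝓞 K) (v.adicCompletion K) a) = _ at this
    rw [this]
    exact (v.valuation_lt_one_iff_mem a).2 ha
  refine Finite.of_surjective (Ideal.Quotient.lift v.asIdeal f hf) ?_
  refine Ideal.Quotient.lift_surjective_of_surjective _ hf ?_
  intro y
  obtain ⟨x, rfl⟩ := IsLocalRing.residue_surjective y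
  obtain ⟨a, ha⟩ := exists_algebraMap_sub_lt_one v x.1 x.2
  refine ⟨a, ?_⟩
  refine sub_eq_zero.1 ?_
  change IsLocalRing.residue _ _ - _ = 0
  rw [← map_sub]
  refine (IsLocalRing.residue_eq_zero_iff _).2 ?_
  exact Valuation.Integer.not_isUnit_iff_valuation_lt_one.2 ha

instance compactSpace_adicCompletionIntegers (K : Type*) [Field K] [NumberField K]
    (v : HeightOneSpectrum (𝓞 K)) : CompactSpace (v.adicCompletionIntegers K) := by
  have : CompleteSpace 𝒪[v.adicCompletion K] :=
    (Valued.isClosed_integer (v.adicCompletion K)).completeSpace_coe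
  have : CompactSpace 𝒪[v.adicCompletion K] :=
    Valued.integer.compactSpace_iff_completeSpace_and_isDiscreteValuationRing_and_finite_residueField.2
     ⟨this, inferInstanceAs (IsDiscreteValuationRing (v.adicCompletionIntegers K)), finite_residueField_adicCompletion K v⟩
  exact this

/-- `𝒫_K`: the non-zero prime ideals of the ring of integers `𝔬` of `K`. -/
abbrev Primes (K : Type*) [Field K] [NumberField K] : Type _ := HeightOneSpectrum (𝓞 K)

/-- `N_K = 𝒫_K ∪ {∞}`; the element `none` is `∞`. -/
abbrev Places (K : Type*) [Field K] [NumberField K] : Type _ := Option (Primes K)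

/-- The positive generator `p` of `𝔭 ∩ ℤ`, i.e. the rational prime with `𝔭 ∣ p`. -/
def primeBelow {K : Type*} [Field K] [NumberField K] (𝔭 : Primes K) : ℕ :=
  Ideal.absNorm (𝔭.asIdeal.under ℤ)

theorem primeBelow_prime {K : Type*} [Field K] [NumberField K] (𝔭 : Primes K) :
    (primeBelow 𝔭).Prime := by
  have := 𝔭.isPrime
  have : Finite (𝓞 K ⧸ 𝔭.asIdeal) := Ideal.finiteQuotientOfFreeOfNeBot _ 𝔭.ne_bot
  exact Nat.absNorm_under_prime 𝔭.asIdeal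

theorem under_eq_span_primeBelow {K : Type*} [Field K] [NumberField K] (𝔭 : Primes K) :
    𝔭.asIdeal.under ℤ = Ideal.span {(primeBelow 𝔭 : ℤ)} :=
  (Int.ideal_span_absNorm_eq_self _).symm

/-- The normalized Haar measure `ν_𝔭` of the compact group `𝔬_𝔭^d`, on its Borel `σ`-algebra. -/
def localHaar {K : Type*} [Field K] [NumberField K] (d : ℕ) (𝔭 : Primes K) :
    @Measure (Fin d → 𝔭.adicCompletionIntegers K) (borel _) :=
  letI : MeasurableSpace (Fin d → 𝔭.adicCompletionIntegers K) := borel _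
  haveI : BorelSpace (Fin d → 𝔭.adicCompletionIntegers K) := ⟨rfl⟩
  Measure.addHaarMeasure ⊤

open scoped Classical in
/-- The Haar measure `ν_∞` on `k_∞ = 𝔬 ⊗ ℝ`, realised as Minkowski space
`ℝ^{r₁} × ℂ^{r₂}`: the canonical measure (`2^{r₂}` times Lebesgue measure, for which the lattice
`𝔬` has covolume `|Δ_K|^{1/2}`) divided by `|Δ_K|^{1/2}`. -/
def nuInfty (K : Type*) [Field K] [NumberField K] : Measure (mixedEmbedding.mixedSpace K) :=
  ENNReal.ofReal (2 ^ InfinitePlace.nrComplexPlaces K / √|(discr K : ℝ)|) • volume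

/-- The product measure on `k_∞^d`, again denoted `ν_∞`. It is a positive multiple of Lebesgue
measure. -/
def nuInftyPi (K : Type*) [Field K] [NumberField K] (d : ℕ) :
    Measure (Fin d → mixedEmbedding.mixedSpace K) :=
  Measure.pi fun _ => nuInfty K

/-- A family of subsets `U_𝔭 ⊆ 𝔬_𝔭^d` (`𝔭 ∈ 𝒫_K`) and `U_∞ ⊆ k_∞^d`. -/
structure System (K : Type*) [Field K] [NumberField K] (d : ℕ) where
  atPrime : ∀ 𝔭 : Primes K, Set (Fin d → 𝔭.adicCompletionIntegers K)
  atInfty : Set (Fin d → mixedEmbedding.mixedSpace K)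

/-- An integral basis of `𝔬`, indexed by `{0, …, k - 1}` with `k = [K : ℚ]`. -/
abbrev IntegralBasis (K : Type*) [Field K] [NumberField K] : Type _ :=
  Module.Basis (Fin (Module.finrank ℚ K)) ℤ (𝓞 K)

/-- `O(H, 𝔼)^d`: vectors whose entries have all their `𝔼`-coordinates in `[-H, H[`. -/
def box {K : Type*} [Field K] [NumberField K] (E : IntegralBasis K) (d H : ℕ) :
    Set (Fin d → 𝓞 K) :=
  {A | ∀ i j, E.repr (A i) j ∈ Set.Ico (-(H : ℤ)) H}

theorem box_finite {K : Type*} [Field K] [NumberField K] (E : IntegralBasis K) (d H : ℕ) :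
    (box E d H).Finite := by
  have h : (Set.univ.pi fun _ : Fin d => Set.univ.pi fun _ : Fin (Module.finrank ℚ K) =>
      Set.Ico (-(H : ℤ)) H).Finite :=
    Set.Finite.pi fun _ => Set.Finite.pi fun _ => Set.finite_Ico _ _
  refine Set.Finite.of_finite_image (f := fun A i j => E.repr (A i) j) (h.subset ?_) ?_
  · rintro _ ⟨A, hA, rfl⟩ i - j -
    exact hA i j
  · intro A _ B _ hAB
    funext i
    refine E.repr.injective (Finsupp.ext fun j => ?_)
    exact congrFun (congrFun hAB i) j

/-- The box `{∑ a_j e_j : a_j ∈ [-1, 1]}^d` in `k_∞^d` spanned by the integral basis. -/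
def realBox {K : Type*} [Field K] [NumberField K] (E : IntegralBasis K) (d : ℕ) :
    Set (Fin d → mixedEmbedding.mixedSpace K) :=
  {x | ∀ i, ∃ a : Fin (Module.finrank ℚ K) → ℝ, (∀ j, a j ∈ Set.Icc (-1) 1) ∧
    x i = ∑ j, a j • mixedEmbedding K (E j : K)}

/-- The upper density of a set `T ⊆ 𝔬^d` with respect to the integral basis `𝔼`. -/
def upperDensity {K : Type*} [Field K] [NumberField K] {d : ℕ} (E : IntegralBasis K)
    (T : Set (Fin d → 𝓞 K)) : ℝ :=
  limsup (fun H : ℕ => ((T ∩ box E d H).ncard : ℝ) /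
    (2 * (H : ℝ)) ^ (d * Module.finrank ℚ K)) atTop

namespace System

variable {K : Type*} [Field K] [NumberField K] {d : ℕ}

/-- `U_η ∩ 𝔬^d`, where `𝔬^d` is embedded in `𝔬_𝔭^d` and in `k_∞^d` in the canonical way. -/
def globalSet (U : System K d) : Places K → Set (Fin d → 𝓞 K)
  | some 𝔭 => {A | (fun i => algebraMap (𝓞 K) (𝔭.adicCompletionIntegers K) (A i)) ∈ U.atPrime 𝔭}
  | none => {A | (fun i => mixedEmbedding K (A i : K)) ∈ U.atInfty}

/-- The set `{η ∈ N_K : A ∈ U_η}`. -/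
def placesOf (U : System K d) (A : Fin d → 𝓞 K) : Set (Places K) := {η | A ∈ U.globalSet η}

/-- The set `I` of all `A ∈ 𝔬^d` lying in `U_η` for infinitely many `η`. -/
def badSet (U : System K d) : Set (Fin d → 𝓞 K) := {A | (U.placesOf A).Infinite}

/-- `O(H, 𝔼)_I^d`, i.e. `O(H, 𝔼)^d` without the elements of `I`. -/
def goodBox (U : System K d) (E : IntegralBasis K) (H : ℕ) : Set (Fin d → 𝓞 K) :=
  box E d H \ U.badSet

theorem goodBox_finite (U : System K d) (E : IntegralBasis K) (H : ℕ) :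
    (U.goodBox E H).Finite :=
  (box_finite E d H).subset Set.sdiff_subset

/-- The elements of `𝔬^d` lying in `U_𝔭` for some `𝔭` above a rational prime `p > M`. -/
def tailSet (U : System K d) (M : ℕ) : Set (Fin d → 𝓞 K) :=
  {A | ∃ 𝔭 : Primes K, M < primeBelow 𝔭 ∧ A ∈ U.globalSet (some 𝔭)}

/-- `s_𝔭 = ν_𝔭(U_𝔭)` and `s_∞ = 2^{-dk} ν_∞(U_∞ ∩ {∑ a_j e_j : a_j ∈ [-1, 1]}^d)`. -/
def s (U : System K d) (E : IntegralBasis K) : Places K → ℝ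
  | some 𝔭 => (localHaar d 𝔭 (U.atPrime 𝔭)).toReal
  | none => 1 / 2 ^ (d * Module.finrank ℚ K) *
      (nuInftyPi K d (U.atInfty ∩ realBox E d)).toReal

/-- The average over `O(H, 𝔼)_I^d` whose limit for `H → ∞` is the `n`-th moment `μ_{n,𝔼}`. The
sets `placesOf A` that occur are finite, so `Set.ncard` is their cardinality. -/
def momentAverage (U : System K d) (E : IntegralBasis K) (n H : ℕ) : ℝ :=
  (∑ A ∈ (U.goodBox_finite E H).toFinset, ((U.placesOf A).ncard : ℝ) ^ n) /
    (2 * (H : ℝ)) ^ (Module.finrank ℚ K * d)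

end System

/-- The threshold `c' H^α` for `α ∈ [0, ∞]`, with `H^∞ = ∞`. -/
def threshold (c' : ℤ) (α : ℝ≥0∞) (H : ℕ) : EReal :=
  ((c' : ℝ) : EReal) * if α = ∞ then ⊤ else (((H : ℝ) ^ α.toReal : ℝ) : EReal)

/-- The vectors `τ ∈ ℕ^n` with `∑_{j=1}^n j τ_j = n`; the entry `τ_j` is `τ (j - 1)` below. -/
def partitionTypes (n : ℕ) : Finset (Fin n → ℕ) :=
  (Fintype.piFinset fun _ => Finset.range (n + 1)).filter
    fun τ => ∑ j : Fin n, ((j : ℕ) + 1) * τ j = n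

theorem mem_partitionTypes {n : ℕ} {τ : Fin n → ℕ} :
    τ ∈ partitionTypes n ↔ ∑ j : Fin n, ((j : ℕ) + 1) * τ j = n := by
  simp only [partitionTypes, Finset.mem_filter, Fintype.mem_piFinset, Finset.mem_range,
    and_iff_right_iff_imp]
  intro h j
  have h1 := Finset.single_le_sum
    (f := fun j : Fin n => ((j : ℕ) + 1) * τ j) (fun _ _ => Nat.zero_le _) (Finset.mem_univ j)
  simp only [h] at h1
  nlinarith

/-- `ℓ(τ) = ∑ τ_j`. -/
def partLength {n : ℕ} (τ : Fin n → ℕ) : ℕ := ∑ j, τ j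

/-- `c(τ)`: the number of partitions of an `n`-element set with exactly `τ_j` blocks of
cardinality `j` for every `j`. -/
def partCount {n : ℕ} (τ : Fin n → ℕ) : ℕ :=
  Nat.card {P : Finpartition (Finset.univ : Finset (Fin n)) //
    ∀ j : Fin n, (P.parts.filter fun B => B.card = (j : ℕ) + 1).card = τ j}

end LocalToGlobal

end

open LocalToGlobal

/-! The `n`-th power of the number of places `η` with `A ∈ U_η` counts the `n`-tuples of such
places. Summing over `A` and exchanging sums turns the moment into a sum, over tuples `t`, of the
density of the intersection of the sets `U_(t j)`. Only the distinct entries of `t` matter, so this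
density should be the product of `s_η` over the image of `t`. Grouping tuples by the partition of
the index set into fibres then gives the stated formula (`tsum_prod_image_eq`).

Two points need proof. The first is independence of finitely many places
(`tendsto_ncard_box_inter_places`). In integral coordinates the box and the cone `U_∞` become the
dilates of one bounded region with null boundary, while each condition at a prime can be squeezed
between clopen ones, which depend only on residues modulo an open subgroup. Since `𝔬^d` is dense in
every finite product of the `𝔬_𝔭^d`, residue conditions can be averaged over integral translates,
and a translate changes the count in a large dilate only by a boundary term. The exceptional set `I`
lies in every tail set, hence has density zero and can be removed.

The second is the exchange of the limit in `H` with the infinite sum over tuples. It follows from a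
tail bound uniform in `H` (`exists_finset_tail_le`). Truncating to ∞ and the primes above `p ≤ M`
changes only the contribution of those `A` in the tail set of `M`. For these the number of places is
at most a constant plus the number of small primes outside a fixed finite set. The constant part is
negligible because the tail set has small upper density, and the `n`-th moment of the rest is at
most the `n`-th power of a tail of `∑ |v_𝔭|`. The abstract lemma `summable_and_tendsto_moment` turns
this bound and the finite densities into convergence both of the series and of the moments. -/

namespace LocalToGlobal

/-! ### Lattice points in dilates of bounded regions -/

section LatticePoints

variable {ι : Type*}

/-- The integral points of the dilate `H • W`. -/
def dilatePoints (W : Set (ι → ℝ)) (H : ℕ) : Set (ι → ℤ) :=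
  {a | (H : ℝ)⁻¹ • (fun i => (a i : ℝ)) ∈ W}

theorem dilatePoints_mono {W W' : Set (ι → ℝ)} (h : W ⊆ W') (H : ℕ) :
    dilatePoints W H ⊆ dilatePoints W' H := fun _ ha => h ha

variable [Fintype ι]

theorem dilatePoints_finite {W : Set (ι → ℝ)} (hW : Bornology.IsBounded W) {H : ℕ} (hH : 0 < H) :
    (dilatePoints W H).Finite := by
  obtain ⟨R, hR⟩ := hW.subset_closedBall 0
  have hH' : (0 : ℝ) < H := by exact_mod_cast hH
  refine Set.Finite.subset (Set.Finite.pi fun _ : ι => Set.finite_Icc (-⌈H * R⌉) ⌈H * R⌉) ?_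
  intro a ha i _
  have h1 := hR ha
  rw [mem_closedBall_zero_iff] at h1
  have h2 := (norm_le_pi_norm _ i).trans h1
  simp only [Pi.smul_apply, smul_eq_mul, Real.norm_eq_abs, abs_mul, abs_inv, Nat.abs_cast] at h2
  rw [inv_mul_le_iff₀ hH'] at h2
  have h3 := h2.trans (Int.le_ceil _)
  rw [← Int.cast_abs, Int.cast_le] at h3
  exact abs_le.1 h3

theorem ncard_dilatePoints (W : Set (ι → ℝ)) {H : ℕ} (hH : 0 < H) :
    (dilatePoints W H).ncard =
      Nat.card ↑(W ∩ (H : ℝ)⁻¹ • (Submodule.span ℤ (Set.range (Pi.basisFun ℝ ι)) : Set (ι → ℝ))) := by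
  have : NeZero H := ⟨hH.ne'⟩
  have hH' : (H : ℝ) ≠ 0 := by exact_mod_cast hH.ne'
  have hinj : Function.Injective fun a : ι → ℤ => (H : ℝ)⁻¹ • (fun i => (a i : ℝ)) := by
    intro a b hab
    have := smul_right_injective (ι → ℝ) (inv_ne_zero hH') hab
    funext i
    exact_mod_cast congrFun this i
  rw [Nat.card_coe_set_eq, ← Set.ncard_image_of_injective _ hinj]
  congr 1
  ext x
  have key := BoxIntegral.unitPartition.mem_smul_span_iff (n := H) (v := x)
  constructor
  · rintro ⟨a, ha, rfl⟩
    refine ⟨ha, key.2 fun i => ⟨a i, ?_⟩⟩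
    simp [hH']
  · rintro ⟨hx, hL⟩
    choose a ha using key.1 hL
    have hxa : (H : ℝ)⁻¹ • (fun i => (a i : ℝ)) = x := by
      funext i
      have := ha i
      simp only [algebraMap_int_eq, eq_intCast] at this
      simp [this, hH']
    exact ⟨a, by simpa [dilatePoints, hxa] using hx, hxa⟩

/-- No measurability of `W` is needed: its interior and closure are measurable, differ from it by a
null set, and their counts enclose the count for `W`. -/
theorem tendsto_ncard_dilatePoints {W : Set (ι → ℝ)} (hW : Bornology.IsBounded W)
    (hW0 : volume (frontier W) = 0) :
    Tendsto (fun H : ℕ => ((dilatePoints W H).ncard : ℝ) / (H : ℝ) ^ Fintype.card ι) atTop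
      (𝓝 (volume.real W)) := by
  have aux : ∀ V : Set (ι → ℝ), Bornology.IsBounded V → MeasurableSet V →
      volume (frontier V) = 0 → Tendsto (fun H : ℕ => ((dilatePoints V H).ncard : ℝ) /
        (H : ℝ) ^ Fintype.card ι) atTop (𝓝 (volume.real V)) := by
    intro V h1 h2 h3
    refine (tendsto_card_div_pow_atTop_volume V h1 h2 h3).congr' ?_
    filter_upwards [eventually_gt_atTop 0] with H hH
    rw [ncard_dilatePoints V hH]
  have hi := aux (interior W) (hW.subset interior_subset) isOpen_interior.measurableSet
    (measure_mono_null (frontier_interior_subset) hW0)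
  have hc := aux (closure W) hW.closure isClosed_closure.measurableSet
    (measure_mono_null (frontier_closure_subset) hW0)
  rw [measureReal_congr (interior_ae_eq_of_null_frontier hW0)] at hi
  rw [measureReal_congr (closure_ae_eq_of_null_frontier hW0)] at hc
  refine tendsto_of_tendsto_of_tendsto_of_le_of_le' hi hc ?_ ?_
  · filter_upwards [eventually_gt_atTop 0] with H hH
    refine div_le_div_of_nonneg_right (Nat.cast_le.2 ?_) (by positivity)
    exact Set.ncard_le_ncard (dilatePoints_mono interior_subset H) (dilatePoints_finite hW hH)
  · filter_upwards [eventually_gt_atTop 0] with H hH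
    refine div_le_div_of_nonneg_right (Nat.cast_le.2 ?_) (by positivity)
    exact Set.ncard_le_ncard (dilatePoints_mono subset_closure H)
      (dilatePoints_finite hW.closure hH)

/-- A segment is connected, so it cannot pass from `W` to its complement without meeting the
frontier. -/
theorem exists_mem_frontier_dist_le {E : Type*} [NormedAddCommGroup E] [NormedSpace ℝ E]
    {W : Set E} {x y : E} (hx : x ∈ W) (hy : y ∉ W) :
    ∃ z ∈ frontier W, dist x z ≤ dist x y := by
  have hpre : IsPreconnected (segment ℝ x y) := (convex_segment x y).isPreconnected
  by_contra! h
  have hdis : ∀ z ∈ segment ℝ x y, z ∉ frontier W := fun z hz hzf =>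
    absurd (h z hzf) (not_lt.2 (by
      have := mem_segment_iff_wbtw.1 hz
      exact this.dist_add_dist ▸ le_add_of_nonneg_right dist_nonneg))
  have := hpre (interior W) (closure W)ᶜ isOpen_interior isClosed_closure.isOpen_compl
    (fun z hz => by
      by_contra hcon
      simp only [Set.mem_union, Set.mem_compl_iff, not_or, not_not] at hcon
      exact hdis z hz ⟨hcon.2, hcon.1⟩)
    ⟨x, left_mem_segment ℝ x y, by
      by_contra hcon
      exact hdis x (left_mem_segment ℝ x y) ⟨subset_closure hx, hcon⟩⟩
    ⟨y, right_mem_segment ℝ x y, fun hcon =>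
      hdis y (right_mem_segment ℝ x y) ⟨hcon, fun h => hy (interior_subset h)⟩⟩
  obtain ⟨z, -, hz1, hz2⟩ := this
  exact hz2 (subset_closure (interior_subset hz1))

/-- A point lost under the shift by `b` lies, after rescaling, within `‖b‖ / H` of the frontier of
`W`, hence eventually in any fixed thickening of it, and thickenings of a compact null set have
arbitrarily small volume. -/
theorem tendsto_ncard_dilatePoints_diff {W : Set (ι → ℝ)} (hW : Bornology.IsBounded W)
    (hW0 : volume (frontier W) = 0) (b : ι → ℤ) :
    Tendsto (fun H : ℕ => (({a | a ∈ dilatePoints W H ∧ a + b ∉ dilatePoints W H} :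
      Set (ι → ℤ)).ncard : ℝ) / (H : ℝ) ^ Fintype.card ι) atTop (𝓝 0) := by
  have hfb : Bornology.IsBounded (frontier W) := hW.closure.subset frontier_subset_closure
  -- The radii are chosen so that the thickenings themselves have null frontier; otherwise their
  -- lattice points could not be counted.
  obtain ⟨rs, hrs0, hrs⟩ := exists_null_frontiers_thickening volume (frontier W)
  have hvol : Tendsto (fun m => volume.real (Metric.thickening (rs m) (frontier W))) atTop (𝓝 0) := by
    have h1 := tendsto_measure_thickening_of_isClosed (μ := volume) (s := frontier W)
      ⟨1, one_pos, (hfb.thickening).measure_lt_top.ne⟩ isClosed_frontier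
    rw [hW0] at h1
    have h2 : Tendsto rs atTop (𝓝[>] 0) :=
      tendsto_nhdsWithin_iff.2 ⟨hrs0, Eventually.of_forall fun m => (hrs m).1⟩
    have := (ENNReal.tendsto_toReal ENNReal.zero_ne_top).comp (h1.comp h2)
    simpa [Measure.real, Function.comp_def] using this
  refine tendsto_order.2 ⟨fun x hx => Eventually.of_forall fun H => hx.trans_le (by positivity),
    fun x hx => ?_⟩
  obtain ⟨m, hm⟩ := ((tendsto_order.1 hvol).2 x hx).exists
  have hT := tendsto_ncard_dilatePoints (hfb.thickening (δ := rs m)) (hrs m).2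
  have hb0 : Tendsto (fun H : ℕ => ‖(H : ℝ)⁻¹ • (fun i => (b i : ℝ))‖) atTop (𝓝 0) := by
    have := (tendsto_inv_atTop_nhds_zero_nat (𝕜 := ℝ)).smul_const (fun i => (b i : ℝ))
    simpa using this.norm
  filter_upwards [(tendsto_order.1 hT).2 x hm, (tendsto_order.1 hb0).2 _ (hrs m).1,
    eventually_gt_atTop 0] with H h1 h2 hH
  refine lt_of_le_of_lt ?_ h1
  refine div_le_div_of_nonneg_right (Nat.cast_le.2 ?_) (by positivity)
  refine Set.ncard_le_ncard ?_ (dilatePoints_finite hfb.thickening hH)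
  rintro a ⟨ha, hab⟩
  obtain ⟨z, hz, hd⟩ := exists_mem_frontier_dist_le (W := W) ha hab
  refine Metric.mem_thickening_iff.2 ⟨z, hz, hd.trans_lt ?_⟩
  have hsub : (H : ℝ)⁻¹ • (fun i => (a i : ℝ)) - (H : ℝ)⁻¹ • (fun i => ((a + b) i : ℝ)) =
      -((H : ℝ)⁻¹ • (fun i => (b i : ℝ))) := by
    funext i
    simp only [Pi.sub_apply, Pi.smul_apply, Pi.neg_apply, Pi.add_apply, smul_eq_mul, Int.cast_add]
    ring
  rw [dist_eq_norm, hsub, norm_neg]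
  exact h2

end LatticePoints

/-! ### Clopen sets and open subgroups in compact groups -/

theorem exists_isClopen_sandwich {X : Type*} [TopologicalSpace X] [CompactSpace X] [T2Space X]
    [TotallyDisconnectedSpace X] [MeasurableSpace X]
    [BorelSpace X] (μ : Measure X) [IsFiniteMeasure μ] [μ.OuterRegular] {B : Set X}
    (hB : μ (frontier B) = 0) {ε : ℝ} (hε : 0 < ε) :
    ∃ C₁ C₂ : Set X, IsClopen C₁ ∧ IsClopen C₂ ∧ C₁ ⊆ B ∧ B ⊆ C₂ ∧
      |μ.real C₁ - μ.real B| < ε ∧ |μ.real C₂ - μ.real B| < ε := by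
  -- A clopen `C` of small measure is found around the frontier. Removing it from `B` or adding it
  -- to `B` absorbs the whole boundary, which makes both results clopen.
  obtain ⟨V, hV, hVo, hVμ⟩ := (frontier B).exists_isOpen_lt_of_lt (μ := μ) (ENNReal.ofReal ε)
    (by simpa [hB] using hε)
  obtain ⟨C, hC, hfC, hCV⟩ := exists_clopen_of_closed_subset_open isClosed_frontier hVo hV
  have hCε : μ.real C < ε := by
    have := (measure_mono hCV).trans_lt hVμ
    exact (ENNReal.lt_ofReal_iff_toReal_lt (measure_ne_top _ _)).1 this
  have hcl : B ∪ C = closure B ∪ C := by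
    rw [closure_eq_self_union_frontier, Set.union_assoc, Set.union_eq_right.2 hfC]
  have hint : B ∪ C = interior B ∪ C := by
    refine Set.Subset.antisymm ?_ (Set.union_subset_union_left _ interior_subset)
    rintro x (hx | hx)
    · by_cases h : x ∈ interior B
      · exact Or.inl h
      · exact Or.inr (hfC ⟨subset_closure hx, h⟩)
    · exact Or.inr hx
  have hcl' : B \ C = closure B \ C := by
    rw [closure_eq_self_union_frontier, Set.union_sdiff_distrib, Set.sdiff_eq_empty.2 hfC,
      Set.union_empty]
  have hint' : B \ C = interior B \ C := by
    refine Set.Subset.antisymm ?_ (Set.sdiff_subset_sdiff_left interior_subset)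
    rintro x ⟨hx, hxC⟩
    refine ⟨?_, hxC⟩
    by_contra h
    exact hxC (hfC ⟨subset_closure hx, h⟩)
  refine ⟨B \ C, B ∪ C, ⟨?_, ?_⟩, ⟨?_, ?_⟩, Set.sdiff_subset, Set.subset_union_left, ?_, ?_⟩
  · rw [hcl', Set.sdiff_eq]
    exact isClosed_closure.inter hC.compl.isClosed
  · rw [hint', Set.sdiff_eq]
    exact isOpen_interior.inter hC.compl.isOpen
  · rw [hcl]
    exact isClosed_closure.union hC.isClosed
  · rw [hint]
    exact isOpen_interior.union hC.isOpen
  · have h1 : μ.real (B \ C) ≤ μ.real B := measureReal_mono Set.sdiff_subset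
    have h2 : μ.real B ≤ μ.real (B \ C) + μ.real C :=
      (measureReal_mono (by rw [Set.sdiff_union_self]; exact Set.subset_union_left)).trans
        (measureReal_union_le _ _)
    rw [abs_lt]
    constructor <;> linarith
  · have h1 : μ.real B ≤ μ.real (B ∪ C) := measureReal_mono Set.subset_union_left
    have h2 : μ.real (B ∪ C) ≤ μ.real B + μ.real C := measureReal_union_le _ _
    rw [abs_lt]
    constructor <;> linarith

section CompactGroup

variable {G : Type*} [AddCommGroup G] [TopologicalSpace G] [IsTopologicalAddGroup G]

/-- By compactness one neighbourhood of `0` translates all of `C` into itself, and it contains an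
open subgroup because the group is profinite. Thus `C` is a union of cosets. -/
theorem exists_openAddSubgroup_add_mem [CompactSpace G] [T2Space G] [TotallyDisconnectedSpace G] {C : Set G}
    (hC : IsClopen C) :
    ∃ N : OpenAddSubgroup G, ∀ x ∈ C, ∀ y ∈ N, x + y ∈ C := by
  have hev : ∀ᶠ y in 𝓝 (0 : G), ∀ x ∈ C, x + y ∈ C := by
    refine hC.isClosed.isCompact.eventually_forall_of_forall_eventually fun x hx => ?_
    have : Tendsto (fun z : G × G => z.2 + z.1) (𝓝 (0, x)) (𝓝 x) := by
      have h : Continuous fun z : G × G => z.2 + z.1 := by fun_prop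
      simpa using h.tendsto (0, x)
    exact this (hC.isOpen.mem_nhds hx)
  obtain ⟨V, hV, hVo, h0⟩ := eventually_nhds_iff.1 hev
  obtain ⟨N, hN⟩ := ProfiniteGrp.exist_openNormalAddSubgroup_sub_open_nhds_of_zero hVo h0
  exact ⟨⟨N.toAddSubgroup, N.isOpen'⟩, fun x hx y hy => hV y (hN hy) x hx⟩

/-- All cosets have the same measure by invariance, and together they have measure one. -/
theorem measureReal_mul_card_quotient [MeasurableSpace G] [BorelSpace G] (μ : Measure G)
    [IsProbabilityMeasure μ] [μ.IsAddLeftInvariant] (N : OpenAddSubgroup G)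
    [Fintype (G ⧸ (N : AddSubgroup G))] (D : Finset (G ⧸ (N : AddSubgroup G))) :
    μ.real ((QuotientAddGroup.mk : G → G ⧸ (N : AddSubgroup G)) ⁻¹' D) *
      Fintype.card (G ⧸ (N : AddSubgroup G)) = D.card := by
  set m : G → G ⧸ (N : AddSubgroup G) := QuotientAddGroup.mk with hm
  have hfib : ∀ q, MeasurableSet (m ⁻¹' {q}) ∧ μ.real (m ⁻¹' {q}) = μ.real (N : Set G) := by
    intro q
    obtain ⟨g, rfl⟩ := QuotientAddGroup.mk_surjective q
    have : m ⁻¹' {m g} = (fun x => -g + x) ⁻¹' (N : Set G) := by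
      ext x
      simp only [hm, Set.mem_preimage, Set.mem_singleton_iff, SetLike.mem_coe]
      rw [eq_comm, QuotientAddGroup.eq]
      rfl
    change MeasurableSet (m ⁻¹' {m g}) ∧ μ.real (m ⁻¹' {m g}) = _
    rw [this]
    refine ⟨(N.isOpen.preimage (by fun_prop)).measurableSet, ?_⟩
    rw [measureReal_def, measure_preimage_add, measureReal_def]
  have hsum : ∀ D : Finset (G ⧸ (N : AddSubgroup G)),
      μ.real (m ⁻¹' D) = D.card * μ.real (N : Set G) := by
    intro D
    have : m ⁻¹' (D : Set _) = ⋃ q ∈ D, m ⁻¹' {q} := by ext; simp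
    rw [this, measureReal_biUnion_finset, Finset.sum_congr rfl fun q _ => (hfib q).2]
    · simp
    · intro a _ b _ hab
      exact Disjoint.preimage _ (by simpa using hab)
    · exact fun q _ => (hfib q).1
  have huniv := hsum Finset.univ
  rw [Finset.coe_univ, Set.preimage_univ, probReal_univ, Finset.card_univ] at huniv
  rw [hsum, mul_assoc, mul_comm (μ.real _), ← huniv, mul_one]

end CompactGroup

/-! ### Joint density of real and profinite conditions -/

section JointDensity

variable {ι : Type*} [Fintype ι]

/-- Shifting `T` amounts to shifting the region, so the two counts differ by at most the points
crossing the boundary under `b` or `-b`. -/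
theorem tendsto_average_translate {W : Set (ι → ℝ)} (hW : Bornology.IsBounded W)
    (hW0 : volume (frontier W) = 0) (T : Set (ι → ℤ)) (b : ι → ℤ) :
    Tendsto (fun H : ℕ => (((dilatePoints W H ∩ {a | a + b ∈ T}).ncard : ℝ) -
      ((dilatePoints W H ∩ T).ncard : ℝ)) / (H : ℝ) ^ Fintype.card ι) atTop (𝓝 0) := by
  have h1 := tendsto_ncard_dilatePoints_diff hW hW0 b
  have h2 := tendsto_ncard_dilatePoints_diff hW hW0 (-b)
  have h2' := h2.neg
  rw [neg_zero] at h2'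
  refine tendsto_of_tendsto_of_tendsto_of_le_of_le' h2' h1 ?_ ?_
  · filter_upwards [eventually_gt_atTop 0] with H hH
    have hf := dilatePoints_finite hW hH
    rw [← neg_div]
    refine div_le_div_of_nonneg_right ?_ (by positivity)
    rw [neg_le_sub_iff_le_add, ← Nat.cast_add, Nat.cast_le,
      ← Set.ncard_image_of_injective (dilatePoints W H ∩ {a | a + b ∈ T}) (add_left_injective b)]
    refine (Set.ncard_le_ncard (t := _ ∪ _) ?_ ?_).trans (Set.ncard_union_le _ _)
    · rintro a ⟨ha, haT⟩
      by_cases h : a + -b ∈ dilatePoints W H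
      · exact Or.inl ⟨a + -b, ⟨h, by simpa using haT⟩, by simp⟩
      · exact Or.inr ⟨ha, h⟩
    · exact ((hf.inter_of_left _).image _).union (hf.subset fun a ha => ha.1)
  · filter_upwards [eventually_gt_atTop 0] with H hH
    have hf := dilatePoints_finite hW hH
    refine div_le_div_of_nonneg_right ?_ (by positivity)
    rw [sub_le_iff_le_add', ← Nat.cast_add, Nat.cast_le,
      ← Set.ncard_image_of_injective (dilatePoints W H ∩ T) (add_left_injective (-b))]
    refine (Set.ncard_le_ncard (t := _ ∪ _) ?_ ?_).trans (Set.ncard_union_le _ _)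
    · rintro a ⟨ha, haT⟩
      by_cases h : a + b ∈ dilatePoints W H
      · exact Or.inl ⟨a + b, ⟨h, haT⟩, by simp⟩
      · exact Or.inr ⟨ha, h⟩
    · exact ((hf.inter_of_left _).image _).union (hf.subset fun a ha => ha.1)

variable {P : Type*} [Fintype P] {G : P → Type*} [∀ p, AddCommGroup (G p)]
  [∀ p, TopologicalSpace (G p)] [∀ p, IsTopologicalAddGroup (G p)] [∀ p, CompactSpace (G p)]
  [∀ p, T2Space (G p)] [∀ p, TotallyDisconnectedSpace (G p)] [∀ p, MeasurableSpace (G p)]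
  [∀ p, BorelSpace (G p)]

/-- The clopen conditions are read in the finite quotients `Q p`. Each element `q` of their product
lifts to an integral shift `b q`; the counts for all these shifts of the condition agree
asymptotically, while their sum is computed exactly by double counting. -/
theorem tendsto_ncard_dilatePoints_inter_isClopen {W : Set (ι → ℝ)} (hW : Bornology.IsBounded W)
    (hW0 : volume (frontier W) = 0) (μ : ∀ p, Measure (G p)) [∀ p, IsProbabilityMeasure (μ p)]
    [∀ p, (μ p).IsAddLeftInvariant] (f : ∀ p, (ι → ℤ) →+ G p)
    (hf : ∀ (N : ∀ p, OpenAddSubgroup (G p)) (x : ∀ p, G p), ∃ b, ∀ p, -x p + f p b ∈ N p)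
    {C : ∀ p, Set (G p)} (hC : ∀ p, IsClopen (C p)) :
    Tendsto (fun H : ℕ => ((dilatePoints W H ∩ {a | ∀ p, f p a ∈ C p}).ncard : ℝ) /
      (H : ℝ) ^ Fintype.card ι) atTop (𝓝 (volume.real W * ∏ p, (μ p).real (C p))) := by
  classical
  choose N hN using fun p => exists_openAddSubgroup_add_mem (hC p)
  let Q : P → Type _ := fun p => G p ⧸ (N p : AddSubgroup (G p))
  have hfin : ∀ p, Finite (Q p) := fun p => (N p : AddSubgroup (G p)).quotient_finite_of_isOpen
    (N p).isOpen
  have : ∀ p, Fintype (Q p) := fun p => Fintype.ofFinite _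
  let m : ∀ p, G p →+ Q p := fun p => QuotientAddGroup.mk' _
  have hm : ∀ p, Function.Surjective (m p) := fun p => QuotientAddGroup.mk'_surjective _
  let D : ∀ p, Finset (Q p) := fun p => Finset.univ.filter fun q => q ∈ m p '' C p
  have hD : ∀ p x, m p x ∈ D p ↔ x ∈ C p := by
    intro p x
    simp only [D, Finset.mem_filter, Finset.mem_univ, true_and]
    refine ⟨?_, fun h => ⟨x, h, rfl⟩⟩
    rintro ⟨y, hy, hyx⟩
    have : -y + x ∈ (N p : AddSubgroup (G p)) := QuotientAddGroup.eq.1 hyx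
    simpa using hN p y hy _ this
  have hcard : ∀ p, (μ p).real (C p) * Fintype.card (Q p) = (D p).card := by
    intro p
    have h := measureReal_mul_card_quotient (μ p) (N p) (D p)
    have h2 : (QuotientAddGroup.mk : G p → Q p) ⁻¹' (D p) = C p := Set.ext fun x => hD p x
    rw [h2] at h
    exact h
  have hb : ∀ q : ∀ p, Q p, ∃ b, ∀ p, m p (f p b) = q p := by
    intro q
    choose x hx using fun p => hm p (q p)
    obtain ⟨b, hb⟩ := hf N x
    exact ⟨b, fun p => by rw [← hx p]; exact (QuotientAddGroup.eq.2 (hb p)).symm⟩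
  choose b hb using hb
  set T : Set (ι → ℤ) := {a | ∀ p, f p a ∈ C p} with hT
  have hTmem : ∀ a q, a + b q ∈ T ↔ ∀ p, m p (f p a) + q p ∈ D p := by
    intro a q
    simp only [hT, Set.mem_ofPred_eq, map_add]
    refine forall_congr' fun p => ?_
    rw [← hD, map_add, hb]
  -- Translation by the residues of `a` permutes the product of the `Q p`, so the number of
  -- successful shifts does not depend on `a`.
  have hcount : ∀ a, (Finset.univ.filter fun q : ∀ p, Q p => a + b q ∈ T).card =
      ∏ p, (D p).card := by
    intro a
    rw [← Fintype.card_piFinset]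
    refine Finset.card_bij (fun q _ p => m p (f p a) + q p) ?_ ?_ ?_
    · intro q hq
      simp only [Finset.mem_filter, Finset.mem_univ, true_and] at hq
      exact Fintype.mem_piFinset.2 ((hTmem a q).1 hq)
    · intro q _ q' _ h
      funext p
      exact add_left_cancel (congrFun h p)
    · intro q hq
      refine ⟨fun p => -m p (f p a) + q p, ?_, by simp⟩
      simp only [Finset.mem_filter, Finset.mem_univ, true_and]
      exact (hTmem a _).2 fun p => by simpa using Fintype.mem_piFinset.1 hq p
  have hsum : ∀ H : ℕ, 0 < H → ∑ q, (dilatePoints W H ∩ {a | a + b q ∈ T}).ncard =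
      (dilatePoints W H).ncard * ∏ p, (D p).card := by
    intro H hH
    have hfi := dilatePoints_finite hW hH
    have h1 : ∀ q, (dilatePoints W H ∩ {a | a + b q ∈ T}).ncard =
        (hfi.toFinset.filter fun a => a + b q ∈ T).card := by
      intro q
      rw [← Set.ncard_coe_finset]
      congr 1
      ext a
      simp
    simp_rw [h1]
    have h2 := Finset.sum_card_bipartiteAbove_eq_sum_card_bipartiteBelow
      (s := (Finset.univ : Finset (∀ p, Q p))) (t := hfi.toFinset) (fun q a => a + b q ∈ T)
    simp only [Finset.bipartiteAbove, Finset.bipartiteBelow, hcount, Finset.sum_const,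
      smul_eq_mul] at h2
    rw [h2, Set.ncard_eq_toFinset_card _ hfi]
  have hlim := tendsto_finsetSum (Finset.univ : Finset (∀ p, Q p)) fun q _ =>
    tendsto_average_translate hW hW0 T (b q)
  have hlim2 := (tendsto_ncard_dilatePoints hW hW0).mul_const (∏ p, ((D p).card : ℝ))
  have hlim3 := hlim2.sub hlim
  have hQ : (Fintype.card (∀ p, Q p) : ℝ) ≠ 0 := by
    have : Nonempty (∀ p, Q p) := ⟨fun p => 0⟩
    exact_mod_cast Fintype.card_ne_zero
  have hlim4 := hlim3.div_const (Fintype.card (∀ p, Q p) : ℝ)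
  convert hlim4.congr' ?_ using 2
  · simp only [Finset.sum_const_zero, sub_zero]
    rw [eq_div_iff hQ, Fintype.card_pi, Nat.cast_prod, mul_assoc, ← Finset.prod_mul_distrib]
    simp only [hcard]
  · filter_upwards [eventually_gt_atTop 0] with H hH
    have h := hsum H hH
    rw [← Finset.sum_div, Finset.sum_sub_distrib, Finset.sum_const, ← Nat.cast_sum, h,
      Finset.card_univ, nsmul_eq_mul]
    push_cast
    field_simp
    ring

theorem tendsto_ncard_dilatePoints_inter {W : Set (ι → ℝ)} (hW : Bornology.IsBounded W)
    (hW0 : volume (frontier W) = 0) (μ : ∀ p, Measure (G p)) [∀ p, IsProbabilityMeasure (μ p)]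
    [∀ p, (μ p).IsAddLeftInvariant] [∀ p, (μ p).OuterRegular] (f : ∀ p, (ι → ℤ) →+ G p)
    (hf : ∀ (N : ∀ p, OpenAddSubgroup (G p)) (x : ∀ p, G p), ∃ b, ∀ p, -x p + f p b ∈ N p)
    {B : ∀ p, Set (G p)} (hB : ∀ p, μ p (frontier (B p)) = 0) :
    Tendsto (fun H : ℕ => ((dilatePoints W H ∩ {a | ∀ p, f p a ∈ B p}).ncard : ℝ) /
      (H : ℝ) ^ Fintype.card ι) atTop (𝓝 (volume.real W * ∏ p, (μ p).real (B p))) := by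
  choose C₁ C₂ hC₁ hC₂ h₁ h₂ hμ₁ hμ₂ using fun (m : ℕ) (p : P) =>
    exists_isClopen_sandwich (μ p) (hB p) (Nat.one_div_pos_of_nat (α := ℝ) (n := m))
  have hlim : ∀ C : ℕ → ∀ p, Set (G p),
      (∀ m p, |(μ p).real (C m p) - (μ p).real (B p)| < 1 / ((m : ℝ) + 1)) →
      Tendsto (fun m => volume.real W * ∏ p, (μ p).real (C m p)) atTop
        (𝓝 (volume.real W * ∏ p, (μ p).real (B p))) := by
    intro C hC
    refine Tendsto.const_mul _ (tendsto_finsetProd _ fun p _ => ?_)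
    rw [tendsto_iff_dist_tendsto_zero]
    exact squeeze_zero (fun _ => dist_nonneg) (fun m => (hC m p).le)
      tendsto_one_div_add_atTop_nhds_zero_nat
  have hmono : ∀ {C C' : ∀ p, Set (G p)}, (∀ p, C p ⊆ C' p) → ∀ H : ℕ, 0 < H →
      ((dilatePoints W H ∩ {a | ∀ p, f p a ∈ C p}).ncard : ℝ) / (H : ℝ) ^ Fintype.card ι ≤
      ((dilatePoints W H ∩ {a | ∀ p, f p a ∈ C' p}).ncard : ℝ) / (H : ℝ) ^ Fintype.card ι := by
    intro C C' h H hH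
    refine div_le_div_of_nonneg_right (Nat.cast_le.2 ?_) (by positivity)
    exact Set.ncard_le_ncard (fun a ha => ⟨ha.1, fun p => h p (ha.2 p)⟩)
      ((dilatePoints_finite hW hH).inter_of_left _)
  refine tendsto_order.2 ⟨fun x hx => ?_, fun x hx => ?_⟩
  · obtain ⟨m, hm⟩ := ((tendsto_order.1 (hlim C₁ hμ₁)).1 x hx).exists
    filter_upwards [(tendsto_order.1 (tendsto_ncard_dilatePoints_inter_isClopen hW hW0 μ f hf
      (hC₁ m))).1 x hm, eventually_gt_atTop 0] with H h hH
    exact h.trans_le (hmono (h₁ m) H hH)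
  · obtain ⟨m, hm⟩ := ((tendsto_order.1 (hlim C₂ hμ₂)).2 x hx).exists
    filter_upwards [(tendsto_order.1 (tendsto_ncard_dilatePoints_inter_isClopen hW hW0 μ f hf
      (hC₂ m))).2 x hm, eventually_gt_atTop 0] with H h hH
    exact (hmono (h₂ m) H hH).trans_lt h

end JointDensity

/-! ### Density of the global integers in finite products of local ones -/

section Approximation

variable {K : Type*} [Field K] [NumberField K]

open WithZero in
theorem exists_forall_valued_le_exp_mem (v : Primes K) {V : Set (v.adicCompletionIntegers K)}
    (hV : V ∈ 𝓝 0) :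
    ∃ m : ℕ, ∀ y : v.adicCompletionIntegers K,
      Valued.v (y : v.adicCompletion K) ≤ exp (-(m : ℤ)) → y ∈ V := by
  obtain ⟨V', hV', hsub⟩ := (mem_nhds_subtype _ _ _).1 hV
  obtain ⟨γ, hγ⟩ := Valued.mem_nhds_zero.1 hV'
  set g : ℤᵐ⁰ := MonoidWithZeroHom.ValueGroup₀.embedding γ.1 with hg
  have hg0 : g ≠ 0 := by
    rw [hg]
    exact (map_ne_zero _).2 γ.ne_zero
  -- The extra `1` makes `exp (-m)` strictly smaller than the radius `g`, since the basic
  -- neighbourhood is an open ball.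
  refine ⟨(1 - log g).toNat, fun y hy => hsub (hγ ?_)⟩
  change (Valued.v.restrict (y : v.adicCompletion K)) < γ.1
  rw [Valuation.restrict_lt_iff_lt_embedding]
  refine hy.trans_lt ?_
  refine (exp_lt_exp.2 ?_).trans_eq (exp_log hg0)
  have := Int.self_le_toNat (1 - log g)
  linarith

open WithZero in
theorem exists_algebraMap_sub_le_exp (v : Primes K) (x : v.adicCompletionIntegers K) (m : ℕ) :
    ∃ a : 𝓞 K, Valued.v (algebraMap (𝓞 K) (v.adicCompletion K) a - x) ≤ exp (-(m : ℤ)) := by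
  -- Division by `c` rescales the ball of radius `exp (-m)` to the open unit ball, so density of `K`
  -- applies; the approximant is then `v`-integral and can be replaced by an element of `𝓞 K`.
  obtain ⟨c, hc⟩ := v.valuedAdicCompletion_surjective K (exp (-(m : ℤ)))
  have hc0 : c ≠ 0 := by
    rintro rfl
    rw [map_zero] at hc
    exact exp_ne_zero hc.symm
  have hopen : IsOpen {y : v.adicCompletion K | Valued.v ((y - x) * c⁻¹) < 1} := by
    have h1 : IsOpen {y : v.adicCompletion K | Valued.v y < 1} := by
      simpa [Valuation.restrict_lt_one_iff] using Valued.isOpen_ball (v.adicCompletion K) 1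
    exact h1.preimage ((continuous_id.sub continuous_const).mul continuous_const)
  obtain ⟨k, hk⟩ := (HeightOneSpectrum.denseRange_algebraMap K v).exists_mem_open hopen
    ⟨x, by simp⟩
  have hk' : Valued.v (algebraMap K (v.adicCompletion K) k - x) < exp (-(m : ℤ)) := by
    have h2 : algebraMap K (v.adicCompletion K) k - x =
        (algebraMap K (v.adicCompletion K) k - x) * c⁻¹ * c := by field_simp
    rw [h2, map_mul, hc]
    exact mul_lt_of_lt_one_left (exp_pos) hk
  have hk1 : v.valuation K k ≤ 1 := by
    rw [← HeightOneSpectrum.valuedAdicCompletion_eq_valuation']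
    have : algebraMap K (v.adicCompletion K) k = (algebraMap K (v.adicCompletion K) k - x) + x := by
      ring
    change Valued.v (algebraMap K (v.adicCompletion K) k) ≤ 1
    rw [this]
    refine (Valuation.map_add _ _ _).trans (max_le (hk'.le.trans ?_) x.2)
    rw [← exp_zero, exp_le_exp]
    simp
  obtain ⟨a, ha⟩ := v.exists_valuation_sub_lt_of_integer hk1
    (Units.mk0 (exp (-(m : ℤ))) exp_ne_zero)
  refine ⟨a, ?_⟩
  have h2 : algebraMap (𝓞 K) (v.adicCompletion K) a - x =
      algebraMap K (v.adicCompletion K) (algebraMap (𝓞 K) K a - k) +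
        (algebraMap K (v.adicCompletion K) k - x) := by
    rw [map_sub, ← IsScalarTower.algebraMap_apply]; ring
  rw [h2]
  refine (Valuation.map_add _ _ _).trans (max_le ?_ hk'.le)
  have := HeightOneSpectrum.valuedAdicCompletion_eq_valuation' v (algebraMap (𝓞 K) K a - k)
  change Valued.v (algebraMap K (v.adicCompletion K) _) = _ at this
  exact (lt_of_eq_of_lt this ha).le

/-- The canonical embedding of `𝔬^d` into `𝔬_𝔭^d`. -/
noncomputable def localEmbedding (d : ℕ) (v : Primes K) :
    (Fin d → 𝓞 K) →+ (Fin d → v.adicCompletionIntegers K) where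
  toFun A i := algebraMap (𝓞 K) (v.adicCompletionIntegers K) (A i)
  map_zero' := by ext; simp
  map_add' A B := by ext; simp

-- Each local target is first approximated by a global integer; the Chinese remainder theorem for
-- the powers `𝔭 ^ m` then merges these integers into one.
open WithZero in
theorem exists_forall_valued_sub_le_exp (S : Finset (Primes K)) (m : ℕ)
    (x : ∀ p : S, p.1.adicCompletionIntegers K) :
    ∃ b : 𝓞 K, ∀ p : S, Valued.v (algebraMap (𝓞 K) (p.1.adicCompletion K) b - x p) ≤
      exp (-(m : ℤ)) := by
  choose a ha using fun p : S => exists_algebraMap_sub_le_exp p.1 (x p) m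
  obtain ⟨b, hb⟩ := IsDedekindDomain.exists_forall_sub_mem_ideal (s := S)
    (fun p : Primes K => p.asIdeal) (fun _ => m) (fun p _ => p.prime)
    (fun p _ q _ hpq h => hpq (HeightOneSpectrum.ext h)) a
  refine ⟨b, fun p => ?_⟩
  have h1 : algebraMap (𝓞 K) (p.1.adicCompletion K) b - x p =
      algebraMap (𝓞 K) (p.1.adicCompletion K) (b - a p) +
        (algebraMap (𝓞 K) (p.1.adicCompletion K) (a p) - x p) := by
    rw [map_sub]; ring
  rw [h1]
  refine (Valuation.map_add _ _ _).trans (max_le ?_ (ha p))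
  have h2 := HeightOneSpectrum.valuedAdicCompletion_eq_valuation p.1 (b - a p) (K := K)
  change Valued.v (algebraMap (𝓞 K) (p.1.adicCompletion K) (b - a p)) = _ at h2
  rw [h2, HeightOneSpectrum.valuation_of_algebraMap, HeightOneSpectrum.intValuation_le_pow_iff_mem]
  exact hb p.1 p.2

/-- This is the density hypothesis of the joint density theorem. One precision, the maximum over
coordinates and primes, serves all the subgroups. -/
theorem exists_forall_neg_add_localEmbedding_mem {d : ℕ} (S : Finset (Primes K))
    (N : ∀ p : S, OpenAddSubgroup (Fin d → p.1.adicCompletionIntegers K))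
    (x : ∀ p : S, Fin d → p.1.adicCompletionIntegers K) :
    ∃ b : Fin d → 𝓞 K, ∀ p : S, -x p + localEmbedding d p.1 b ∈ N p := by
  have hN : ∀ p : S, ∃ m : ℕ, ∀ y : Fin d → p.1.adicCompletionIntegers K,
      (∀ i, Valued.v (y i : p.1.adicCompletion K) ≤ WithZero.exp (-(m : ℤ))) → y ∈ N p := by
    intro p
    have h0 := (N p).mem_nhds_zero
    rw [nhds_pi] at h0
    obtain ⟨I, V, hV, hsub⟩ := Filter.mem_pi'.1 h0
    choose m hm using fun i => exists_forall_valued_le_exp_mem p.1 (hV i)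
    refine ⟨Finset.univ.sup m, fun y hy => hsub fun i _ => hm i _ ((hy i).trans ?_)⟩
    have : m i ≤ Finset.univ.sup m := Finset.le_sup (Finset.mem_univ i)
    exact WithZero.exp_le_exp.2 (by omega)
  choose m hm using hN
  choose b hb using fun i => exists_forall_valued_sub_le_exp S (Finset.univ.sup m) fun p => x p i
  refine ⟨b, fun p => hm p _ fun i => ?_⟩
  have h1 := hb i p
  have h2 : (((-x p + localEmbedding d p.1 b) i : p.1.adicCompletionIntegers K) :
      p.1.adicCompletion K) = algebraMap (𝓞 K) (p.1.adicCompletion K) (b i) - x p i := by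
    rw [sub_eq_neg_add]
    rfl
  rw [h2]
  refine h1.trans (WithZero.exp_le_exp.2 ?_)
  have : m p ≤ Finset.univ.sup m := Finset.le_sup (Finset.mem_univ p)
  omega

end Approximation

/-! ### Coordinates and Haar measure at infinity -/

section Infinity

variable {K : Type*} [Field K] [NumberField K]

open scoped Classical in
/-- The `ℤ`-basis of the lattice `𝔬 ⊆ k_∞` given by an integral basis. -/
noncomputable def latticeIntBasis (E : IntegralBasis K) :
    Module.Basis (Fin (Module.finrank ℚ K)) ℤ (mixedEmbedding.integerLattice K) :=
  E.map (LinearEquiv.ofBijective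
    ((((mixedEmbedding K).comp (algebraMap (𝓞 K) K)).toIntAlgHom.toLinearMap).rangeRestrict)
    ⟨fun x y h => by
      have h1 := congrArg Subtype.val h
      exact RingOfIntegers.coe_injective (mixedEmbedding_injective K h1),
    LinearMap.surjective_rangeRestrict _⟩)

open scoped Classical in
/-- The basis of `k_∞` obtained from an integral basis. -/
noncomputable def realBasis (E : IntegralBasis K) :
    Module.Basis (Fin (Module.finrank ℚ K)) ℝ (mixedEmbedding.mixedSpace K) :=
  (latticeIntBasis E).ofZLatticeBasis ℝ _

theorem realBasis_apply (E : IntegralBasis K) (j : Fin (Module.finrank ℚ K)) :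
    realBasis E j = mixedEmbedding K (E j : K) := by
  simp only [realBasis, Module.Basis.ofZLatticeBasis_apply]
  rfl

instance sigmaFinite_nuInfty : SigmaFinite (nuInfty K) := by
  classical
  exact SMul.sigmaFinite (μ := (volume : Measure (mixedEmbedding.mixedSpace K)))
    (Real.toNNReal (2 ^ InfinitePlace.nrComplexPlaces K / √|(discr K : ℝ)|))

-- Both are Haar measures, so it is enough to compare them on the parallelepiped of the basis; its
-- volume is the covolume of the lattice, which the normalizing factor of `nuInfty` turns into one.
open scoped Classical in
theorem realBasis_addHaar (E : IntegralBasis K) : (realBasis E).addHaar = nuInfty K := by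
  classical
  have hcov := ZLattice.covolume_eq_measure_fundamentalDomain _ volume
    (ZLattice.isAddFundamentalDomain (latticeIntBasis E) volume)
  rw [mixedEmbedding.covolume_integerLattice] at hcov
  change _ = volume.real (ZSpan.fundamentalDomain (realBasis E)) at hcov
  have : (nuInfty K).IsAddLeftInvariant := by
    unfold nuInfty; infer_instance
  rw [Module.Basis.addHaar_eq_iff, Module.Basis.coe_parallelepiped, nuInfty, Measure.smul_apply,
    ← measure_congr (ZSpan.fundamentalDomain_ae_parallelepiped (realBasis E) volume),
    ← ENNReal.ofReal_toReal (ZSpan.fundamentalDomain_isBounded _).measure_lt_top.ne,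
    smul_eq_mul, ← ENNReal.ofReal_mul (by positivity), ← ENNReal.ofReal_one]
  congr 1
  rw [← measureReal_def, ← hcov]
  have : √|(discr K : ℝ)| ≠ 0 := by
    have := discr_ne_zero K
    positivity
  field_simp
  rw [← mul_pow]
  norm_num

/-- The parametrization of `k_∞` by coordinates with respect to an integral basis. -/
noncomputable def coordEquiv (E : IntegralBasis K) :
    (Fin (Module.finrank ℚ K) → ℝ) ≃L[ℝ] mixedEmbedding.mixedSpace K :=
  (realBasis E).equivFunL.symm

theorem measurePreserving_coordEquiv (E : IntegralBasis K) :
    MeasurePreserving (coordEquiv E) volume (nuInfty K) where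
  measurable := (coordEquiv E).continuous.measurable
  map_eq := by
    have h1 : (volume : Measure (Fin (Module.finrank ℚ K) → ℝ)) =
        (Pi.basisFun ℝ (Fin (Module.finrank ℚ K))).addHaar := by
      rw [← addHaarMeasure_eq_volume_pi, ← Module.Basis.parallelepiped_basisFun,
        ← Module.Basis.addHaar_def]
    classical
    rw [h1, Module.Basis.map_addHaar, ← realBasis_addHaar E]
    congr 1
    ext1 j
    rw [Module.Basis.map_apply, Pi.basisFun_apply]
    change (realBasis E).equivFun.symm (Pi.single j 1) = _
    simp [Module.Basis.equivFun_symm_apply, Pi.single_apply]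

theorem measurePreserving_curry {α β : Type*} [Fintype α] [Fintype β] :
    MeasurePreserving (fun (x : α × β → ℝ) a b => x (a, b)) volume volume where
  measurable := by fun_prop
  map_eq := by
    refine (Measure.pi_eq_generateFrom (C := fun _ : α => Set.pi Set.univ ''
      Set.pi Set.univ fun _ : β => {s : Set ℝ | MeasurableSet s}) (fun _ => generateFrom_pi)
      (fun _ => isPiSystem_pi) (fun _ => ?_) ?_).symm
    · exact Measure.FiniteSpanningSetsIn.pi fun _ => volume.toFiniteSpanningSetsIn
    · intro s hs
      choose t ht hts using hs
      rw [Measure.map_apply (by fun_prop) (MeasurableSet.univ_pi fun a => by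
        rw [← hts a]; exact MeasurableSet.univ_pi fun b => ht a b trivial)]
      have : (fun (x : α × β → ℝ) a b => x (a, b)) ⁻¹' Set.univ.pi s =
          Set.univ.pi fun p : α × β => t p.1 p.2 := by
        ext x
        simp [← hts, Set.mem_pi]
      rw [this, volume_pi_pi, Fintype.prod_prod_type]
      refine Finset.prod_congr rfl fun a _ => ?_
      rw [← hts a, volume_pi_pi]

/-- The parametrization of `k_∞^d` by coordinates with respect to an integral basis. -/
noncomputable def coordMap (E : IntegralBasis K) (d : ℕ) :
    (Fin d × Fin (Module.finrank ℚ K) → ℝ) ≃ₜ (Fin d → mixedEmbedding.mixedSpace K) where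
  toFun x i := coordEquiv E fun j => x (i, j)
  invFun y p := (coordEquiv E).symm (y p.1) p.2
  left_inv x := by simp
  right_inv y := by ext1 i; simp
  continuous_toFun := by fun_prop
  continuous_invFun := by fun_prop

theorem measurePreserving_coordMap (E : IntegralBasis K) (d : ℕ) :
    MeasurePreserving (coordMap E d) volume (nuInftyPi K d) := by
  exact (measurePreserving_pi (fun _ : Fin d => volume) (fun _ => nuInfty K)
    fun _ => measurePreserving_coordEquiv E).comp measurePreserving_curry

theorem coordMap_smul (E : IntegralBasis K) (d : ℕ) (r : ℝ)
    (x : Fin d × Fin (Module.finrank ℚ K) → ℝ) : coordMap E d (r • x) = r • coordMap E d x := by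
  ext1 i
  exact (coordEquiv E).map_smul r _

theorem coordEquiv_apply (E : IntegralBasis K) (x) :
    coordEquiv E x = ∑ j, x j • mixedEmbedding K (E j : K) := by
  change (realBasis E).equivFun.symm x = _
  rw [Module.Basis.equivFun_symm_apply]
  simp only [realBasis_apply]

/-- The coordinates of a vector in `𝔬^d` with respect to an integral basis. -/
noncomputable def coordInt (E : IntegralBasis K) (d : ℕ) :
    (Fin d × Fin (Module.finrank ℚ K) → ℤ) ≃+ (Fin d → 𝓞 K) where
  toFun a i := E.equivFun.symm fun j => a (i, j)
  invFun A p := E.equivFun (A p.1) p.2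
  left_inv a := by
    funext p
    exact congrFun (E.equivFun.apply_symm_apply fun j => a (p.1, j)) p.2
  right_inv A := by
    funext i
    exact E.equivFun.symm_apply_apply (A i)
  map_add' a b := by
    ext1 i
    exact map_add E.equivFun.symm (fun j => a (i, j)) (fun j => b (i, j))

theorem coordMap_intCast (E : IntegralBasis K) (d : ℕ)
    (a : Fin d × Fin (Module.finrank ℚ K) → ℤ) :
    coordMap E d (fun p => (a p : ℝ)) = fun i => mixedEmbedding K (coordInt E d a i : K) := by
  ext1 i
  change coordEquiv E _ = _
  rw [coordEquiv_apply]
  change _ = mixedEmbedding K ((E.equivFun.symm fun j => a (i, j) : 𝓞 K) : K)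
  rw [Module.Basis.equivFun_symm_apply]
  change _ = ((mixedEmbedding K).comp (algebraMap (𝓞 K) K)) _
  rw [map_sum]
  refine Finset.sum_congr rfl fun j _ => ?_
  rw [map_zsmul, ← Int.cast_smul_eq_zsmul ℝ]
  rfl

theorem coordMap_mem_realBox (E : IntegralBasis K) (d : ℕ)
    (x : Fin d × Fin (Module.finrank ℚ K) → ℝ) :
    coordMap E d x ∈ realBox E d ↔ ∀ p, x p ∈ Set.Icc (-1 : ℝ) 1 := by
  constructor
  · rintro h ⟨i, j⟩
    obtain ⟨a, ha, hax⟩ := h i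
    rw [← coordEquiv_apply] at hax
    have := congrFun ((coordEquiv E).injective hax) j
    change x (i, j) = _ at this
    rw [this]
    exact ha j
  · intro h i
    exact ⟨fun j => x (i, j), fun j => h _, coordEquiv_apply E _⟩

/-- The half-open cube `[-1, 1[^ι`. -/
def halfOpenBox (ι : Type*) : Set (ι → ℝ) := {x | ∀ i, x i ∈ Set.Ico (-1 : ℝ) 1}

theorem halfOpenBox_eq_pi (ι : Type*) :
    halfOpenBox ι = Set.univ.pi fun _ => Set.Ico (-1 : ℝ) 1 := by
  ext; simp [halfOpenBox]

theorem isBounded_halfOpenBox (ι : Type*) [Fintype ι] : Bornology.IsBounded (halfOpenBox ι) := by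
  rw [halfOpenBox_eq_pi]
  exact Bornology.IsBounded.pi fun _ => Metric.isBounded_Ico _ _

theorem volume_frontier_halfOpenBox (ι : Type*) [Fintype ι] :
    volume (frontier (halfOpenBox ι)) = 0 := by
  refine Convex.addHaar_frontier volume ?_
  rw [halfOpenBox_eq_pi]
  exact convex_pi fun _ _ => convex_Ico _ _

/-- Reconciles the half-open boxes in which points are counted with the closed box that defines
`s_∞`. -/
theorem halfOpenBox_ae_eq (ι : Type*) [Fintype ι] :
    halfOpenBox ι =ᵐ[volume] {x | ∀ i, x i ∈ Set.Icc (-1 : ℝ) 1} := by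
  have : {x : ι → ℝ | ∀ i, x i ∈ Set.Icc (-1 : ℝ) 1} = Set.univ.pi fun _ => Set.Icc (-1 : ℝ) 1 := by
    ext x; simp only [Set.mem_univ_pi, Set.mem_ofPred_eq]
  rw [this, halfOpenBox_eq_pi]
  exact Measure.pi_Ico_ae_eq_pi_Icc

theorem volume_real_halfOpenBox (ι : Type*) [Fintype ι] :
    volume.real (halfOpenBox ι) = 2 ^ Fintype.card ι := by
  rw [halfOpenBox_eq_pi, measureReal_def, Real.volume_pi_Ico_toReal (fun _ => by norm_num)]
  norm_num

end Infinity

/-! ### Densities for finitely many places -/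

section Density

variable {K : Type*} [Field K] [NumberField K] {d : ℕ}

theorem coordInt_mem_box (E : IntegralBasis K) {H : ℕ} (hH : 0 < H)
    (a : Fin d × Fin (Module.finrank ℚ K) → ℤ) :
    coordInt E d a ∈ box E d H ↔ a ∈ dilatePoints (halfOpenBox _) H := by
  have hH' : (0 : ℝ) < H := by exact_mod_cast hH
  have h1 : ∀ i j, E.repr (coordInt E d a i) j = a (i, j) := fun i j =>
    congrFun (E.equivFun.apply_symm_apply fun j => a (i, j)) j
  simp only [box, dilatePoints, halfOpenBox, Set.mem_ofPred_eq, h1, Prod.forall, Set.mem_Ico,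
    Pi.smul_apply, smul_eq_mul]
  refine forall_congr' fun i => forall_congr' fun j => and_congr ?_ ?_
  · rw [← div_eq_inv_mul, le_div_iff₀ hH', neg_one_mul]
    exact_mod_cast Iff.rfl
  · rw [← div_eq_inv_mul, div_lt_iff₀ hH', one_mul]
    exact_mod_cast Iff.rfl

/-- Invariance under positive scaling lets the condition at infinity be tested on the point divided
by `H`, so that it becomes membership in the dilate of a fixed region. -/
theorem coordInt_mem_cone (E : IntegralBasis K) {V : Set (Fin d → mixedEmbedding.mixedSpace K)}
    (hV : ∀ r : ℝ, 0 < r → ∀ x ∈ V, r • x ∈ V) {H : ℕ} (hH : 0 < H)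
    (a : Fin d × Fin (Module.finrank ℚ K) → ℤ) :
    (fun i => mixedEmbedding K (coordInt E d a i : K)) ∈ V ↔
      a ∈ dilatePoints (coordMap E d ⁻¹' V) H := by
  have hH' : (0 : ℝ) < H := by exact_mod_cast hH
  rw [← coordMap_intCast]
  simp only [dilatePoints, Set.mem_ofPred_eq, Set.mem_preimage, coordMap_smul]
  refine ⟨fun h => hV _ (inv_pos.2 hH') _ h, fun h => ?_⟩
  have := hV _ hH' _ h
  rwa [smul_smul, mul_inv_cancel₀ hH'.ne', one_smul] at this

theorem measurableEmbedding_coordMap (E : IntegralBasis K) (d : ℕ) :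
    MeasurableEmbedding (coordMap E d) :=
  (coordMap E d).measurableEmbedding

theorem volume_real_halfOpenBox_inter (E : IntegralBasis K)
    (V : Set (Fin d → mixedEmbedding.mixedSpace K)) :
    volume.real (halfOpenBox _ ∩ coordMap E d ⁻¹' V) = (nuInftyPi K d (V ∩ realBox E d)).toReal := by
  rw [← (measurePreserving_coordMap E d).measure_preimage_emb (measurableEmbedding_coordMap E d),
    measureReal_def]
  congr 1
  refine measure_congr ?_
  rw [Set.preimage_inter, Set.inter_comm]
  refine (ae_eq_refl _).inter ?_
  have h : coordMap E d ⁻¹' realBox E d = {x | ∀ p, x p ∈ Set.Icc (-1 : ℝ) 1} :=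
    Set.ext fun x => coordMap_mem_realBox E d x
  rw [h]
  exact halfOpenBox_ae_eq _

instance isProbabilityMeasure_localHaar (𝔭 : Primes K) :
    @IsProbabilityMeasure _ (borel _) (localHaar d 𝔭) := by
  let _ : MeasurableSpace (Fin d → 𝔭.adicCompletionIntegers K) := borel _
  have : BorelSpace (Fin d → 𝔭.adicCompletionIntegers K) := ⟨rfl⟩
  exact ⟨Measure.addHaarMeasure_self (K₀ := ⊤)⟩

/-- The elements of `𝔬^d` whose image in `k_∞^d` lies in `V`. -/
def inftySet (V : Set (Fin d → mixedEmbedding.mixedSpace K)) : Set (Fin d → 𝓞 K) :=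
  {A | (fun i => mixedEmbedding K (A i : K)) ∈ V}

/-- The cone `V` is kept free: it is `U_∞` when ∞ is among the places considered and the whole space
otherwise. -/
theorem tendsto_ncard_box_inter (E : IntegralBasis K) (U : System K d)
    (hU : ∀ 𝔭 : Primes K, localHaar d 𝔭 (frontier (U.atPrime 𝔭)) = 0)
    {V : Set (Fin d → mixedEmbedding.mixedSpace K)} (hV : nuInftyPi K d (frontier V) = 0)
    (hcone : ∀ r : ℝ, 0 < r → ∀ x ∈ V, r • x ∈ V) (S : Finset (Primes K)) :
    Tendsto (fun H : ℕ => ((box E d H ∩ (inftySet V ∩ ⋂ 𝔭 ∈ S, U.globalSet (some 𝔭))).ncard : ℝ) /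
      (2 * (H : ℝ)) ^ (Module.finrank ℚ K * d)) atTop
      (𝓝 (1 / 2 ^ (d * Module.finrank ℚ K) * (nuInftyPi K d (V ∩ realBox E d)).toReal *
        ∏ 𝔭 ∈ S, U.s E (some 𝔭))) := by
  let _ : ∀ p : S, MeasurableSpace (Fin d → p.1.adicCompletionIntegers K) := fun _ => borel _
  have : ∀ p : S, BorelSpace (Fin d → p.1.adicCompletionIntegers K) := fun _ => ⟨rfl⟩
  have : ∀ p : S, IsProbabilityMeasure (localHaar d p.1) := fun p =>
    isProbabilityMeasure_localHaar p.1
  have : ∀ p : S, (localHaar d p.1).IsAddLeftInvariant := fun p => by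
    unfold localHaar; infer_instance
  have : ∀ p : S, (localHaar d p.1).OuterRegular := fun p => by
    unfold localHaar; infer_instance
  have hWb : Bornology.IsBounded (halfOpenBox _ ∩ coordMap E d ⁻¹' V) :=
    (isBounded_halfOpenBox _).subset Set.inter_subset_left
  have hW0 : volume (frontier (halfOpenBox _ ∩ coordMap E d ⁻¹' V)) = 0 := by
    refine measure_mono_null (frontier_inter_subset _ _) (measure_union_null ?_ ?_)
    · exact measure_mono_null Set.inter_subset_left (volume_frontier_halfOpenBox _)
    · refine measure_mono_null Set.inter_subset_right ?_
      rw [← (coordMap E d).preimage_frontier, (measurePreserving_coordMap E d).measure_preimage_emb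
        (measurableEmbedding_coordMap E d), hV]
  have key := tendsto_ncard_dilatePoints_inter hWb hW0 (fun p : S => localHaar d p.1)
    (fun p => (localEmbedding d p.1).comp (coordInt E d : _ →+ _)) (fun N x => by
      obtain ⟨b, hb⟩ := exists_forall_neg_add_localEmbedding_mem S N x
      exact ⟨(coordInt E d).symm b, fun p => by simpa using hb p⟩)
    (B := fun p => U.atPrime p.1) (fun p => hU p.1)
  rw [volume_real_halfOpenBox_inter] at key
  have key2 := key.const_mul (1 / 2 ^ (d * Module.finrank ℚ K))
  rw [← mul_assoc] at key2
  have hprod : ∏ 𝔭 ∈ S, U.s E (some 𝔭) = ∏ p : S, (localHaar d p.1).real (U.atPrime p.1) := by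
    rw [← Finset.prod_coe_sort]
    rfl
  rw [hprod]
  refine key2.congr' ?_
  filter_upwards [eventually_gt_atTop 0] with H hH
  have himg : box E d H ∩ (inftySet V ∩ ⋂ 𝔭 ∈ S, U.globalSet (some 𝔭)) =
      coordInt E d '' (dilatePoints (halfOpenBox _ ∩ coordMap E d ⁻¹' V) H ∩
        {a | ∀ p : S, (localEmbedding d p.1).comp (coordInt E d : _ →+ _) a ∈ U.atPrime p.1}) := by
    ext A
    obtain ⟨a, rfl⟩ := (coordInt E d).surjective A
    rw [(coordInt E d).injective.mem_set_image]
    have h1 := coordInt_mem_box E hH a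
    have h2 := coordInt_mem_cone E hcone hH a
    have h3 : coordInt E d a ∈ (⋂ 𝔭 ∈ S, U.globalSet (some 𝔭)) ↔
        ∀ p : S, (localEmbedding d p.1).comp (coordInt E d : _ →+ _) a ∈ U.atPrime p.1 := by
      rw [Set.mem_iInter₂]
      exact ⟨fun h p => h p.1 p.2, fun h p hp => h ⟨p, hp⟩⟩
    rw [Set.mem_inter_iff, Set.mem_inter_iff, h1, h3, inftySet, Set.mem_ofPred_eq, h2, ← and_assoc]
    rfl
  rw [himg, Set.ncard_image_of_injective _ (coordInt E d).injective, Fintype.card_prod,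
    Fintype.card_fin, Fintype.card_fin, mul_pow, mul_comm (Module.finrank ℚ K) d]
  field_simp

theorem one_div_mul_nuInftyPi_realBox (E : IntegralBasis K) :
    1 / 2 ^ (d * Module.finrank ℚ K) * (nuInftyPi K d (Set.univ ∩ realBox E d)).toReal = 1 := by
  rw [← volume_real_halfOpenBox_inter, Set.preimage_univ, Set.inter_univ, volume_real_halfOpenBox,
    Fintype.card_prod, Fintype.card_fin, Fintype.card_fin]
  field_simp

theorem tendsto_ncard_box_inter_places (E : IntegralBasis K) (U : System K d)
    (hU : ∀ 𝔭 : Primes K, localHaar d 𝔭 (frontier (U.atPrime 𝔭)) = 0)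
    (hUinf : nuInftyPi K d (frontier U.atInfty) = 0)
    (hcone : Set.Ici (0 : ℝ) • U.atInfty = U.atInfty) (F : Finset (Places K)) :
    Tendsto (fun H : ℕ => ((box E d H ∩ ⋂ η ∈ F, U.globalSet η).ncard : ℝ) /
      (2 * (H : ℝ)) ^ (Module.finrank ℚ K * d)) atTop (𝓝 (∏ η ∈ F, U.s E η)) := by
  classical
  by_cases hF : none ∈ F
  · have h := tendsto_ncard_box_inter E U hU hUinf (fun r hr x hx => by
      rw [← hcone]
      exact Set.smul_mem_smul (Set.mem_Ici.2 hr.le) hx) F.eraseNone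
    have hF' : F = Finset.insertNone F.eraseNone := by
      rw [Finset.insertNone_eraseNone, Finset.insert_eq_of_mem hF]
    have h1 : ∏ η ∈ F, U.s E η = U.s E none * ∏ 𝔭 ∈ F.eraseNone, U.s E (some 𝔭) := by
      conv_lhs => rw [hF', Finset.prod_insertNone]
    have h2 : (⋂ η ∈ F, U.globalSet η) =
        inftySet U.atInfty ∩ ⋂ 𝔭 ∈ F.eraseNone, U.globalSet (some 𝔭) := by
      ext A
      simp only [Set.mem_iInter, Set.mem_inter_iff, Finset.mem_eraseNone]
      constructor
      · exact fun h => ⟨h none hF, fun p hp => h _ hp⟩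
      · rintro ⟨h1, h2⟩ (_ | p) hp
        · exact h1
        · exact h2 p hp
    rw [h1, h2]
    exact h
  · have h := tendsto_ncard_box_inter E U hU (V := Set.univ) (by simp) (fun _ _ _ _ => trivial)
      F.eraseNone
    rw [one_div_mul_nuInftyPi_realBox, one_mul] at h
    have h1 : ∏ η ∈ F, U.s E η = ∏ 𝔭 ∈ F.eraseNone, U.s E (some 𝔭) := by
      conv_lhs => rw [← Finset.erase_eq_of_notMem hF, ← Finset.map_some_eraseNone, Finset.prod_map]
      rfl
    have h2 : (⋂ η ∈ F, U.globalSet η) =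
        inftySet Set.univ ∩ ⋂ 𝔭 ∈ F.eraseNone, U.globalSet (some 𝔭) := by
      ext A
      simp only [Set.mem_iInter, Set.mem_inter_iff, Finset.mem_eraseNone]
      constructor
      · exact fun h => ⟨trivial, fun p hp => h _ hp⟩
      · rintro ⟨-, h2⟩ (_ | p) hp
        · exact absurd hp hF
        · exact h2 p hp
    rw [h1, h2]
    exact h

end Density

/-! ### Removing the exceptional set -/

section GoodDensity

variable {K : Type*} [Field K] [NumberField K] {d : ℕ}

/-- All these primes divide the non-zero ideal generated by `M!`. -/
theorem finite_setOf_primeBelow_le (M : ℕ) : {𝔭 : Primes K | primeBelow 𝔭 ≤ M}.Finite := by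
  have h0 : Ideal.span {((M.factorial : ℕ) : 𝓞 K)} ≠ 0 := by
    rw [Ne, Ideal.zero_eq_bot, Ideal.span_singleton_eq_bot, Nat.cast_eq_zero]
    exact M.factorial_ne_zero
  refine (Ideal.finite_factors h0).subset fun 𝔭 h𝔭 => ?_
  have h1 : ((primeBelow 𝔭 : ℕ) : ℤ) ∈ 𝔭.asIdeal.under ℤ := by
    rw [under_eq_span_primeBelow]
    exact Ideal.mem_span_singleton_self _
  have h2 : ((primeBelow 𝔭 : ℕ) : 𝓞 K) ∈ 𝔭.asIdeal := by
    simpa [Ideal.under_def, Ideal.mem_comap] using h1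
  refine Ideal.dvd_span_singleton.2 ?_
  obtain ⟨c, hc⟩ := Nat.dvd_factorial (primeBelow_prime 𝔭).pos h𝔭
  rw [hc, Nat.cast_mul]
  exact Ideal.mul_mem_right _ _ h2

/-- Only finitely many places remain when the primes above `p > M` are excluded. -/
theorem badSet_subset_tailSet (U : System K d) (M : ℕ) : U.badSet ⊆ U.tailSet M := by
  intro A hA
  by_contra h
  refine hA ((((finite_setOf_primeBelow_le (K := K) M).image some).insert none).subset ?_)
  rintro (_ | 𝔭) hη
  · exact Set.mem_insert _ _
  · refine Set.mem_insert_of_mem _ ⟨𝔭, ?_, rfl⟩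
    by_contra hlt
    exact h ⟨𝔭, not_le.1 hlt, hη⟩

theorem tendsto_ncard_box (E : IntegralBasis K) :
    Tendsto (fun H : ℕ => ((box E d H).ncard : ℝ) /
      (2 * (H : ℝ)) ^ (Module.finrank ℚ K * d)) atTop (𝓝 1) := by
  -- With no place imposed the system is irrelevant, so the empty one is used.
  have h := tendsto_ncard_box_inter_places E (d := d) ⟨fun _ => ∅, ∅⟩ (by simp) (by simp) (by simp) ∅
  simpa using h

theorem eventually_ncard_inter_box_lt (E : IntegralBasis K) {T : Set (Fin d → 𝓞 K)} {ε : ℝ}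
    (hT : upperDensity E T < ε) :
    ∀ᶠ H : ℕ in atTop, ((T ∩ box E d H).ncard : ℝ) /
      (2 * (H : ℝ)) ^ (Module.finrank ℚ K * d) < ε := by
  rw [mul_comm (Module.finrank ℚ K) d]
  refine eventually_lt_of_limsup_lt hT ?_
  -- A real `limsup` controls eventual values only for a sequence bounded above; the count of the
  -- whole box provides the bound.
  have h := (tendsto_ncard_box (d := d) E).isBoundedUnder_le
  rw [mul_comm (Module.finrank ℚ K) d] at h
  refine h.mono_le (Eventually.of_forall fun H => ?_)
  refine div_le_div_of_nonneg_right (Nat.cast_le.2 ?_) (by positivity)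
  exact Set.ncard_le_ncard Set.inter_subset_right (box_finite E d H)

theorem tendsto_ncard_badSet_inter_box (E : IntegralBasis K) (U : System K d)
    (htail : Tendsto (fun M : ℕ => upperDensity E (U.tailSet M)) atTop (𝓝 0)) :
    Tendsto (fun H : ℕ => ((U.badSet ∩ box E d H).ncard : ℝ) /
      (2 * (H : ℝ)) ^ (Module.finrank ℚ K * d)) atTop (𝓝 0) := by
  refine tendsto_order.2 ⟨fun x hx => Eventually.of_forall fun H => hx.trans_le (by positivity),
    fun x hx => ?_⟩
  obtain ⟨M, hM⟩ := ((tendsto_order.1 htail).2 x hx).exists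
  filter_upwards [eventually_ncard_inter_box_lt E hM] with H hH
  refine lt_of_le_of_lt ?_ hH
  refine div_le_div_of_nonneg_right (Nat.cast_le.2 ?_) (by positivity)
  exact Set.ncard_le_ncard (Set.inter_subset_inter_left _ (badSet_subset_tailSet U M))
    ((box_finite E d H).inter_of_right _)

theorem tendsto_ncard_goodBox_inter (E : IntegralBasis K) (U : System K d)
    (hU : ∀ 𝔭 : Primes K, localHaar d 𝔭 (frontier (U.atPrime 𝔭)) = 0)
    (hUinf : nuInftyPi K d (frontier U.atInfty) = 0)
    (hcone : Set.Ici (0 : ℝ) • U.atInfty = U.atInfty)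
    (htail : Tendsto (fun M : ℕ => upperDensity E (U.tailSet M)) atTop (𝓝 0))
    (F : Finset (Places K)) :
    Tendsto (fun H : ℕ => ((U.goodBox E H ∩ ⋂ η ∈ F, U.globalSet η).ncard : ℝ) /
      (2 * (H : ℝ)) ^ (Module.finrank ℚ K * d)) atTop (𝓝 (∏ η ∈ F, U.s E η)) := by
  have h1 := tendsto_ncard_box_inter_places E U hU hUinf hcone F
  have h2 := h1.sub (tendsto_ncard_badSet_inter_box E U htail)
  rw [sub_zero] at h2
  refine tendsto_of_tendsto_of_tendsto_of_le_of_le h2 h1 (fun H => ?_) (fun H => ?_)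
  · simp only []
    rw [← sub_div]
    refine div_le_div_of_nonneg_right ?_ (by positivity)
    rw [sub_le_iff_le_add, ← Nat.cast_add, Nat.cast_le]
    refine (Set.ncard_le_ncard (t := _ ∪ _) ?_ ?_).trans (Set.ncard_union_le _ _)
    · rintro A ⟨hA, hAF⟩
      by_cases h : A ∈ U.badSet
      · exact Or.inr ⟨h, hA⟩
      · exact Or.inl ⟨⟨hA, h⟩, hAF⟩
    · exact ((U.goodBox_finite E H).inter_of_left _).union ((box_finite E d H).inter_of_right _)
  · refine div_le_div_of_nonneg_right (Nat.cast_le.2 ?_) (by positivity)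
    exact Set.ncard_le_ncard (Set.inter_subset_inter_left _ Set.sdiff_subset)
      ((box_finite E d H).inter_of_left _)

end GoodDensity

/-! ### Moments as sums over tuples -/

section Moments

open Finset

open scoped Classical in
theorem sum_card_filter_pow {Λ N : Type*} (B : Finset Λ) (F : Finset N) (S : N → Set Λ) (n : ℕ) :
    ∑ A ∈ B, (F.filter fun η => A ∈ S η).card ^ n =
      ∑ t ∈ Fintype.piFinset fun _ : Fin n => F, (B.filter fun A => ∀ j, A ∈ S (t j)).card := by
  have h : ∀ A, (F.filter fun η => A ∈ S η).card ^ n =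
      ((Fintype.piFinset fun _ : Fin n => F).filter fun t => ∀ j, A ∈ S (t j)).card := by
    intro A
    have h1 : ((Fintype.piFinset fun _ : Fin n => F).filter fun t => ∀ j, A ∈ S (t j)) =
        Fintype.piFinset fun _ : Fin n => F.filter fun η => A ∈ S η := by
      ext t
      simp [Fintype.mem_piFinset, forall_and]
    rw [h1, Fintype.card_piFinset]
    simp
  simp_rw [h]
  have h3 := sum_card_bipartiteAbove_eq_sum_card_bipartiteBelow
    (s := Fintype.piFinset fun _ : Fin n => F) (t := B) (fun t A => ∀ j, A ∈ S (t j))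
  simpa only [bipartiteAbove, bipartiteBelow] using h3.symm

/-- The moments `a F` truncated to a finite `F` converge to finite partial sums `L F` of the series.
They bound the full moments `b` from below, and by `htail` from above up to `ε`; this bounds all
partial sums and locates the limit. -/
theorem summable_and_tendsto_moment {Λ N : Type*} [DecidableEq N] (n : ℕ) (S : N → Set Λ)
    (B : ℕ → Finset Λ) (D : ℕ → ℝ) (hD : ∀ᶠ H in atTop, 0 < D H) (s : N → ℝ) (hs : ∀ η, 0 ≤ s η)
    (hdens : ∀ F : Finset N, Tendsto (fun H => (((B H : Set Λ) ∩ ⋂ η ∈ F, S η).ncard : ℝ) / D H)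
      atTop (𝓝 (∏ η ∈ F, s η)))
    (hfin : ∀ H, ∀ A ∈ B H, {η | A ∈ S η}.Finite)
    (htail : ∀ ε : ℝ, 0 < ε → ∃ F : Finset N, ∀ᶠ H in atTop,
      (∑ A ∈ B H, (({η | A ∈ S η}.ncard : ℝ) ^ n - (({η | η ∈ F ∧ A ∈ S η}).ncard : ℝ) ^ n)) / D H
        ≤ ε) :
    Summable (fun t : Fin n → N => ∏ η ∈ univ.image t, s η) ∧
    Tendsto (fun H => (∑ A ∈ B H, ({η | A ∈ S η}.ncard : ℝ) ^ n) / D H) atTop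
      (𝓝 (∑' t : Fin n → N, ∏ η ∈ univ.image t, s η)) := by
  classical
  set g : (Fin n → N) → ℝ := fun t => ∏ η ∈ univ.image t, s η with hg
  have hg0 : ∀ t, 0 ≤ g t := fun t => prod_nonneg fun η _ => hs η
  set L : Finset N → ℝ := fun F => ∑ t ∈ Fintype.piFinset fun _ : Fin n => F, g t with hL
  set a : Finset N → ℕ → ℝ := fun F H =>
    (∑ A ∈ B H, (({η | η ∈ F ∧ A ∈ S η}).ncard : ℝ) ^ n) / D H with ha
  set b : ℕ → ℝ := fun H => (∑ A ∈ B H, ({η | A ∈ S η}.ncard : ℝ) ^ n) / D H with hb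
  have haL : ∀ F, Tendsto (a F) atTop (𝓝 (L F)) := by
    intro F
    have h := tendsto_finsetSum (Fintype.piFinset fun _ : Fin n => F)
      fun t _ => hdens (univ.image t)
    refine h.congr fun H => ?_
    rw [← sum_div]
    have h1 : ∀ t : Fin n → N, ((B H : Set Λ) ∩ ⋂ η ∈ univ.image t, S η).ncard =
        ((B H).filter fun A => ∀ j, A ∈ S (t j)).card := by
      intro t
      rw [← Set.ncard_coe_finset]
      congr 1
      ext A
      simp
    have h2 : ∀ A, ({η | η ∈ F ∧ A ∈ S η}).ncard = (F.filter fun η => A ∈ S η).card := by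
      intro A
      rw [← Set.ncard_coe_finset]
      congr 1
      ext
      simp
    simp_rw [h1, ha, h2]
    congr 1
    exact_mod_cast (sum_card_filter_pow (B H) F S n).symm
  have hab : ∀ F, ∀ᶠ H in atTop, a F H ≤ b H := by
    intro F
    filter_upwards [hD] with H hH
    refine div_le_div_of_nonneg_right (sum_le_sum fun A hA => ?_) hH.le
    gcongr
    · exact hfin H A hA
    · exact fun hη => hη.2
  have hba : ∀ ε : ℝ, 0 < ε → ∃ F, ∀ᶠ H in atTop, b H ≤ a F H + ε := by
    intro ε hε
    obtain ⟨F, hF⟩ := htail ε hε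
    refine ⟨F, hF.mono fun H h => ?_⟩
    rw [sum_sub_distrib, sub_div] at h
    linarith
  have hbound : ∀ (ε : ℝ) F, (∀ᶠ H in atTop, b H ≤ a F H + ε) →
      ∀ u : Finset (Fin n → N), ∑ t ∈ u, g t ≤ L F + ε := by
    intro ε F hF u
    -- `F'` collects every entry of the tuples in `u`. Passing to the limit in `a F' ≤ b ≤ a F + ε`
    -- compares the sum over `u` with `L F + ε`.
    set F' := u.biUnion fun t => univ.image t
    have h1 : ∑ t ∈ u, g t ≤ L F' := by
      refine sum_le_sum_of_subset_of_nonneg (fun t ht => ?_) fun t _ _ => hg0 t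
      rw [Fintype.mem_piFinset]
      exact fun j => mem_biUnion.2 ⟨t, ht, mem_image_of_mem _ (mem_univ j)⟩
    refine h1.trans (le_of_tendsto_of_tendsto (haL F') ((haL F).add_const ε) ?_)
    filter_upwards [hab F', hF] with H h2 h3
    exact h2.trans h3
  have hsum : Summable g := by
    obtain ⟨F, hF⟩ := hba 1 one_pos
    exact summable_of_sum_le hg0 (hbound 1 F hF)
  refine ⟨hsum, Metric.tendsto_atTop'.2 fun ε hε => ?_⟩
  obtain ⟨F, hF⟩ := hba (ε / 3) (by positivity)
  have h1 : L F ≤ ∑' t, g t := hsum.sum_le_tsum _ fun t _ => hg0 t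
  have h2 : ∑' t, g t ≤ L F + ε / 3 := hsum.tsum_le_of_sum_le (hbound _ F hF)
  have h3 := Metric.tendsto_nhds.1 (haL F) (ε / 3) (by positivity)
  have h4 : ∀ᶠ H in atTop, dist (b H) (∑' t, g t) < ε := by
    filter_upwards [h3, hF, hab F] with H h3 h5 h6
    rw [Real.dist_eq, abs_lt] at *
    constructor <;> linarith
  obtain ⟨H0, hH0⟩ := eventually_atTop.1 h4
  exact ⟨H0, fun H hH => hH0 H hH.le⟩

end Moments

/-! ### The uniform tail estimate -/

section Tail

variable {K : Type*} [Field K] [NumberField K] {d : ℕ}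

/-- The primes outside `F` of size at most `x` at which `A` satisfies the local condition. -/
def smallPrimes (U : System K d) (F : Finset (Primes K)) (x : EReal) (A : Fin d → 𝓞 K) :
    Set (Primes K) :=
  {𝔭 | 𝔭 ∉ F ∧ (primeBelow 𝔭 : EReal) ≤ x ∧ A ∈ U.globalSet (some 𝔭)}

/-- Finiteness ensures that `Set.ncard` is the true cardinality and not the default `0` in the
bounds below. -/
theorem finite_primes_of_notMem_badSet {U : System K d} {A : Fin d → 𝓞 K} (hA : A ∉ U.badSet) :
    {𝔭 : Primes K | A ∈ U.globalSet (some 𝔭)}.Finite := by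
  have h : (U.placesOf A).Finite := Set.not_infinite.1 hA
  exact h.preimage (f := some) (Option.some_injective _).injOn

/-- Expanding the power into tuples of primes from the finite set `Q` of those that occur, each
tuple is bounded by `hsmall`, and the sum of products factors as `(∑ |v|) ^ n`. Absolute values are
needed because `v` may take negative values. -/
theorem sum_ncard_smallPrimes_pow_le (U : System K d) (E : IntegralBasis K) {n H : ℕ} {x : EReal}
    {v : Primes K → ℝ}
    (hsmall : ∀ 𝔭 : Fin n → Primes K, (∀ j, (primeBelow (𝔭 j) : EReal) ≤ x) →
      (((⋂ j, U.globalSet (some (𝔭 j))) ∩ U.goodBox E H).ncard : ℝ) ≤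
        (2 * (H : ℝ)) ^ (Module.finrank ℚ K * d) * ∏ j, v (𝔭 j))
    {F : Finset (Primes K)} {δ : ℝ}
    (hF : ∀ Q : Finset (Primes K), Disjoint Q F → ∑ 𝔭 ∈ Q, |v 𝔭| ≤ δ) :
    ∑ A ∈ (U.goodBox_finite E H).toFinset, ((smallPrimes U F x A).ncard : ℝ) ^ n ≤
      (2 * (H : ℝ)) ^ (Module.finrank ℚ K * d) * δ ^ n := by
  classical
  set B := (U.goodBox_finite E H).toFinset with hB
  have hfin : ∀ A ∈ B, (smallPrimes U F x A).Finite := fun A hA =>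
    (finite_primes_of_notMem_badSet ((Set.Finite.mem_toFinset _).1 hA).2).subset fun _ h => h.2.2
  have hfinQ : (⋃ A ∈ B, smallPrimes U F x A).Finite :=
    B.finite_toSet.biUnion hfin
  set Q := hfinQ.toFinset with hQ
  have hQF : ∀ 𝔭 ∈ Q, 𝔭 ∉ F ∧ (primeBelow 𝔭 : EReal) ≤ x := by
    intro 𝔭 h
    rw [hQ, Set.Finite.mem_toFinset, Set.mem_iUnion₂] at h
    obtain ⟨A, -, h⟩ := h
    exact ⟨h.1, h.2.1⟩
  have h1 : ∀ A ∈ B, (smallPrimes U F x A).ncard =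
      (Q.filter fun 𝔭 => A ∈ U.globalSet (some 𝔭)).card := by
    intro A hA
    rw [← Set.ncard_coe_finset]
    congr 1
    ext 𝔭
    rw [Finset.mem_coe, Finset.mem_filter]
    constructor
    · intro h
      refine ⟨?_, h.2.2⟩
      rw [hQ, Set.Finite.mem_toFinset]
      exact Set.mem_biUnion hA h
    · rintro ⟨h, hA'⟩
      exact ⟨(hQF 𝔭 h).1, (hQF 𝔭 h).2, hA'⟩
  have h2 : ∑ A ∈ B, ((smallPrimes U F x A).ncard : ℝ) ^ n =
      ∑ t ∈ Fintype.piFinset fun _ : Fin n => Q,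
        ((B.filter fun A => ∀ j, A ∈ U.globalSet (some (t j))).card : ℝ) := by
    rw [Finset.sum_congr rfl fun A hA => by rw [h1 A hA]]
    exact_mod_cast sum_card_filter_pow B Q (fun 𝔭 => U.globalSet (some 𝔭)) n
  have h3 : ∀ t ∈ Fintype.piFinset fun _ : Fin n => Q,
      ((B.filter fun A => ∀ j, A ∈ U.globalSet (some (t j))).card : ℝ) ≤
        (2 * (H : ℝ)) ^ (Module.finrank ℚ K * d) * ∏ j, |v (t j)| := by
    intro t ht
    rw [Fintype.mem_piFinset] at ht
    have h4 : (B.filter fun A => ∀ j, A ∈ U.globalSet (some (t j))).card =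
        ((⋂ j, U.globalSet (some (t j))) ∩ U.goodBox E H).ncard := by
      rw [← Set.ncard_coe_finset]
      congr 1
      ext A
      simp [hB, and_comm]
    rw [h4]
    refine (hsmall t fun j => (hQF _ (ht j)).2).trans ?_
    refine mul_le_mul_of_nonneg_left ?_ (by positivity)
    rw [← Finset.abs_prod]
    exact le_abs_self _
  rw [h2]
  refine (Finset.sum_le_sum h3).trans ?_
  rw [← Finset.mul_sum]
  gcongr
  have h5 := Finset.prod_univ_sum (fun _ : Fin n => Q) fun _ 𝔭 => |v 𝔭|
  rw [← h5, Finset.prod_const, Finset.card_univ, Fintype.card_fin]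
  have h6 : Disjoint Q F := Finset.disjoint_left.2 fun 𝔭 h => (hQF 𝔭 h).1
  exact pow_le_pow_left₀ (Finset.sum_nonneg fun _ _ => abs_nonneg _) (hF Q h6) n

theorem ncard_placesOf_le (U : System K d) {A : Fin d → 𝓞 K} (hA : A ∉ U.badSet)
    (F : Finset (Primes K)) (x : EReal) {c : ℤ}
    (hlarge : (({𝔭 : Primes K | x < (primeBelow 𝔭 : EReal) ∧
        A ∈ U.globalSet (some 𝔭)}.ncard : ℕ) : ℤ) < c) :
    (U.placesOf A).ncard ≤ 1 + c.toNat + F.card + (smallPrimes U F x A).ncard := by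
  have hfin := finite_primes_of_notMem_badSet hA
  have hsub : U.placesOf A ⊆ (({none} ∪ some '' {𝔭 : Primes K | x < (primeBelow 𝔭 : EReal) ∧
      A ∈ U.globalSet (some 𝔭)}) ∪ some '' (F : Set (Primes K))) ∪
        some '' smallPrimes U F x A := by
    rintro (_ | 𝔭) h
    · exact Or.inl (Or.inl (Or.inl rfl))
    · by_cases h1 : 𝔭 ∈ F
      · exact Or.inl (Or.inr ⟨𝔭, h1, rfl⟩)
      · by_cases h2 : x < (primeBelow 𝔭 : EReal)
        · exact Or.inl (Or.inl (Or.inr ⟨𝔭, ⟨h2, h⟩, rfl⟩))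
        · exact Or.inr ⟨𝔭, ⟨h1, not_lt.1 h2, h⟩, rfl⟩
  have hf1 : {𝔭 : Primes K | x < (primeBelow 𝔭 : EReal) ∧ A ∈ U.globalSet (some 𝔭)}.Finite :=
    hfin.subset fun _ h => h.2
  have hf2 : (smallPrimes U F x A).Finite := hfin.subset fun _ h => h.2.2
  refine (Set.ncard_le_ncard hsub ((((Set.finite_singleton _).union (hf1.image _)).union
    (F.finite_toSet.image _)).union (hf2.image _))).trans ?_
  refine (Set.ncard_union_le _ _).trans (add_le_add ?_ (Set.ncard_image_le hf2))
  refine (Set.ncard_union_le _ _).trans (add_le_add ?_ ?_)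
  · refine (Set.ncard_union_le _ _).trans (add_le_add (Set.ncard_singleton _).le ?_)
    refine (Set.ncard_image_le hf1).trans ?_
    omega
  · refine (Set.ncard_image_le F.finite_toSet).trans ?_
    rw [Set.ncard_coe_finset]

/-- The order of choices matters: first the set `F` outside which `∑ |v|` is small, which fixes the
constant `C`, and only then `M`, so that the tail set is sparse relative to `C ^ n`. -/
theorem exists_finset_tail_le (E : IntegralBasis K) (U : System K d) {n : ℕ} (hn : 0 < n)
    (htail : Tendsto (fun M : ℕ => upperDensity E (U.tailSet M)) atTop (𝓝 0))
    (x : ℕ → EReal) (c : ℤ)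
    (hlarge : ∀ H : ℕ, 1 ≤ H → ∀ A ∈ U.goodBox E H,
      (({𝔭 : Primes K | x H < (primeBelow 𝔭 : EReal) ∧
        A ∈ U.globalSet (some 𝔭)}.ncard : ℕ) : ℤ) < c)
    (v : Primes K → ℝ)
    (hsmall : ∀ H : ℕ, 1 ≤ H → ∀ 𝔭 : Fin n → Primes K,
      (∀ j, (primeBelow (𝔭 j) : EReal) ≤ x H) →
      (((⋂ j, U.globalSet (some (𝔭 j))) ∩ U.goodBox E H).ncard : ℝ) ≤
        (2 * (H : ℝ)) ^ (Module.finrank ℚ K * d) * ∏ j, v (𝔭 j))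
    (hv : Summable v) {ε : ℝ} (hε : 0 < ε) :
    ∃ F : Finset (Places K), ∀ᶠ H : ℕ in atTop,
      (∑ A ∈ (U.goodBox_finite E H).toFinset, (((U.placesOf A).ncard : ℝ) ^ n -
        (({η | η ∈ F ∧ A ∈ U.globalSet η}).ncard : ℝ) ^ n)) /
          (2 * (H : ℝ)) ^ (Module.finrank ℚ K * d) ≤ ε := by
  classical
  -- The cap at `1` gives `δ ^ n ≤ δ`; the factor `2 ^ (n - 1)` comes from the convexity bound for
  -- `(C + y) ^ n`.
  set δ : ℝ := min 1 (ε / (2 * 2 ^ (n - 1))) with hδ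
  have hδ0 : 0 < δ := lt_min one_pos (by positivity)
  obtain ⟨F, hF⟩ := summable_iff_vanishing_norm.1 hv.abs δ hδ0
  have hF' : ∀ Q : Finset (Primes K), Disjoint Q F → ∑ 𝔭 ∈ Q, |v 𝔭| ≤ δ := fun Q hQ =>
    (le_abs_self _).trans (hF Q hQ).le
  have hδn : 2 ^ (n - 1) * δ ^ n ≤ ε / 2 := by
    have h1 : δ ^ n ≤ δ := pow_le_of_le_one hδ0.le (min_le_left _ _) hn.ne'
    have h2 : δ ≤ ε / (2 * 2 ^ (n - 1)) := min_le_right _ _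
    calc 2 ^ (n - 1) * δ ^ n ≤ 2 ^ (n - 1) * (ε / (2 * 2 ^ (n - 1))) := by gcongr; exact h1.trans h2
      _ = ε / 2 := by field_simp
  set C : ℕ := 1 + c.toNat + F.card with hC
  have hC0 : (0 : ℝ) < C := by rw [hC]; positivity
  obtain ⟨M, hM⟩ := ((tendsto_order.1 htail).2 (ε / (2 * (2 ^ (n - 1) * C ^ n)))
    (by positivity)).exists
  refine ⟨insert none ((finite_setOf_primeBelow_le (K := K) M).toFinset.image some), ?_⟩
  filter_upwards [eventually_ncard_inter_box_lt E hM, eventually_ge_atTop 1] with H hH hH1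
  have hD : (0 : ℝ) < (2 * (H : ℝ)) ^ (Module.finrank ℚ K * d) := by
    have : (0 : ℝ) < H := by exact_mod_cast hH1
    positivity
  rw [div_lt_iff₀ hD] at hH
  rw [div_le_iff₀ hD]
  have hpt : ∀ A ∈ (U.goodBox_finite E H).toFinset, ((U.placesOf A).ncard : ℝ) ^ n -
      (({η | η ∈ insert none ((finite_setOf_primeBelow_le (K := K) M).toFinset.image some) ∧
        A ∈ U.globalSet η}).ncard : ℝ) ^ n ≤
      2 ^ (n - 1) * C ^ n * (if A ∈ U.tailSet M then 1 else 0) +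
        2 ^ (n - 1) * ((smallPrimes U F (x H) A).ncard : ℝ) ^ n := by
    intro A hA
    have hA' := (Set.Finite.mem_toFinset _).1 hA
    by_cases hAt : A ∈ U.tailSet M
    · rw [if_pos hAt, mul_one, ← mul_add]
      have h1 := ncard_placesOf_le U hA'.2 F (x H) (hlarge H hH1 A hA')
      have h2 : ((U.placesOf A).ncard : ℝ) ≤ C + (smallPrimes U F (x H) A).ncard := by
        exact_mod_cast h1
      calc _ ≤ ((U.placesOf A).ncard : ℝ) ^ n := sub_le_self _ (by positivity)
        _ ≤ (C + (smallPrimes U F (x H) A).ncard : ℝ) ^ n := by gcongr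
        _ ≤ _ := add_pow_le (by positivity) (by positivity) n
    -- Off the tail set, every place of `A` belongs to the truncation, so the difference vanishes.
    · have h1 : {η | η ∈ insert none ((finite_setOf_primeBelow_le (K := K) M).toFinset.image some) ∧
          A ∈ U.globalSet η} = U.placesOf A := by
        ext η
        refine ⟨fun h => h.2, fun h => ⟨?_, h⟩⟩
        rcases η with _ | 𝔭
        · exact Finset.mem_insert_self _ _
        · refine Finset.mem_insert_of_mem (Finset.mem_image_of_mem _ ?_)
          rw [Set.Finite.mem_toFinset]
          by_contra hlt
          exact hAt ⟨𝔭, not_le.1 hlt, h⟩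
      rw [h1, sub_self]
      positivity
  refine (Finset.sum_le_sum hpt).trans ?_
  rw [Finset.sum_add_distrib, ← Finset.mul_sum, ← Finset.mul_sum, Finset.sum_boole]
  have h1 : ((((U.goodBox_finite E H).toFinset.filter fun A => A ∈ U.tailSet M).card : ℕ) : ℝ) ≤
      ((U.tailSet M ∩ box E d H).ncard : ℝ) := by
    rw [← Set.ncard_coe_finset, Nat.cast_le]
    refine Set.ncard_le_ncard (fun A hA => ?_) ((box_finite E d H).inter_of_right _)
    rw [Finset.mem_coe, Finset.mem_filter, Set.Finite.mem_toFinset] at hA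
    exact ⟨hA.2, hA.1.1⟩
  have h2 := sum_ncard_smallPrimes_pow_le U E (hsmall H hH1) hF'
  set D := (2 * (H : ℝ)) ^ (Module.finrank ℚ K * d)
  calc _ ≤ 2 ^ (n - 1) * (C : ℝ) ^ n * (ε / (2 * (2 ^ (n - 1) * C ^ n)) * D) +
        2 ^ (n - 1) * (D * δ ^ n) := by
        gcongr
        exact h1.trans hH.le
    _ = ε / 2 * D + (2 ^ (n - 1) * δ ^ n) * D := by field_simp
    _ ≤ ε / 2 * D + ε / 2 * D := by gcongr
    _ = ε * D := by ring

end Tail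

/-! ### Regrouping tuples by their fibre partition -/

section Regrouping

open Finset

variable {N : Type*} {n : ℕ}

/-- The partition of `Fin n` into the fibres of a map. -/
noncomputable def kerPartition (t : Fin n → N) : Finpartition (univ : Finset (Fin n)) :=
  letI : DecidableRel (Setoid.ker t) := Classical.decRel _
  Finpartition.ofSetoid (Setoid.ker t)

theorem mem_part_kerPartition {t : Fin n → N} {i j : Fin n} :
    j ∈ (kerPartition t).part i ↔ t i = t j := by
  let : DecidableRel (Setoid.ker t) := Classical.decRel _
  exact Finpartition.mem_part_ofSetoid_iff_rel

theorem parts_eq_image_part (P : Finpartition (univ : Finset (Fin n))) :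
    P.parts = univ.image P.part := by
  ext B
  rw [mem_image]
  constructor
  · intro hB
    obtain ⟨i, hi⟩ := P.nonempty_of_mem_parts hB
    exact ⟨i, mem_univ i, P.part_eq_of_mem hB hi⟩
  · rintro ⟨i, -, rfl⟩
    exact P.part_mem.2 (mem_univ i)

theorem kerPartition_eq_iff {t : Fin n → N} {P : Finpartition (univ : Finset (Fin n))} :
    kerPartition t = P ↔ ∀ i j, t i = t j ↔ P.part i = P.part j := by
  have key : ∀ i j, P.part i = P.part j ↔ j ∈ P.part i := fun i j => by
    rw [eq_comm, ← P.mem_part_iff_part_eq_part (mem_univ j) (mem_univ i)]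
  constructor
  · rintro rfl i j
    rw [key, mem_part_kerPartition]
  · intro h
    refine Finpartition.ext ?_
    rw [parts_eq_image_part, parts_eq_image_part]
    congr 1
    funext i
    ext j
    rw [mem_part_kerPartition, h, key]

/-- Maps with a given fibre partition correspond to embeddings of the set of blocks. -/
noncomputable def kerFiberEquiv (P : Finpartition (univ : Finset (Fin n))) :
    {t : Fin n → N // kerPartition t = P} ≃ (P.parts ↪ N) where
  toFun t := ⟨fun B => t.1 (P.nonempty_of_mem_parts B.2).choose, fun B B' h => by
    have h1 := (kerPartition_eq_iff.1 t.2 _ _).1 h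
    rw [P.part_eq_of_mem B.2 (P.nonempty_of_mem_parts B.2).choose_spec,
      P.part_eq_of_mem B'.2 (P.nonempty_of_mem_parts B'.2).choose_spec] at h1
    exact Subtype.ext h1⟩
  invFun e := ⟨fun i => e ⟨P.part i, P.part_mem.2 (mem_univ i)⟩, kerPartition_eq_iff.2 fun i j => by
    rw [e.injective.eq_iff, Subtype.mk.injEq]⟩
  left_inv t := by
    refine Subtype.ext (funext fun i => ?_)
    refine (kerPartition_eq_iff.1 t.2 _ _).2 ?_
    have h := P.part_mem.2 (mem_univ i)
    exact P.part_eq_of_mem h (P.nonempty_of_mem_parts h).choose_spec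
  right_inv e := by
    ext B
    change e _ = e B
    congr 1
    exact Subtype.ext (P.part_eq_of_mem B.2 (P.nonempty_of_mem_parts B.2).choose_spec)

variable [DecidableEq N]

theorem prod_image_kerFiberEquiv_symm (P : Finpartition (univ : Finset (Fin n))) (e : P.parts ↪ N)
    (s : N → ℝ) :
    ∏ η ∈ univ.image ((kerFiberEquiv P).symm e).1, s η = ∏ B, s (e B) := by
  have h : univ.image ((kerFiberEquiv P).symm e).1 = univ.image e := by
    ext η
    simp only [mem_image, mem_univ, true_and]
    constructor
    · rintro ⟨i, rfl⟩
      exact ⟨_, rfl⟩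
    · rintro ⟨B, rfl⟩
      obtain ⟨i, hi⟩ := P.nonempty_of_mem_parts B.2
      exact ⟨i, congrArg e (Subtype.ext (P.part_eq_of_mem B.2 hi))⟩
  rw [h, prod_image fun _ _ _ _ h => e.injective h]

theorem tsum_kerPartition_fiber (P : Finpartition (univ : Finset (Fin n))) (s : N → ℝ) :
    ∑' t : {t : Fin n → N // kerPartition t = P}, ∏ η ∈ univ.image t.1, s η =
      ∑' e : Fin P.parts.card ↪ N, ∏ m, s (e m) := by
  rw [← (kerFiberEquiv P).symm.tsum_eq]
  simp_rw [prod_image_kerFiberEquiv_symm]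
  rw [← (Equiv.embeddingCongr P.parts.equivFin (Equiv.refl N)).symm.tsum_eq]
  refine tsum_congr fun e => ?_
  rw [← P.parts.equivFin.prod_comp]
  rfl

/-- The type of a partition: the number of blocks of each cardinality. -/
def partitionType (P : Finpartition (univ : Finset (Fin n))) : Fin n → ℕ :=
  fun j => (P.parts.filter fun B => B.card = (j : ℕ) + 1).card

/-- Used twice: `f = 1` yields the number of blocks, and `f = id` yields the total size `n`. -/
theorem sum_partitionType (P : Finpartition (univ : Finset (Fin n))) (f : ℕ → ℕ) :
    ∑ j : Fin n, f ((j : ℕ) + 1) * partitionType P j = ∑ B ∈ P.parts, f B.card := by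
  have hpos : ∀ B ∈ P.parts, 0 < B.card := fun B hB => (P.nonempty_of_mem_parts hB).card_pos
  have hle : ∀ B ∈ P.parts, B.card ≤ n := fun B _ => by simpa using card_le_univ B
  have h : ∀ j : Fin n, f ((j : ℕ) + 1) * partitionType P j =
      ∑ B ∈ P.parts, if B.card = (j : ℕ) + 1 then f B.card else 0 := by
    intro j
    rw [partitionType, card_eq_sum_ones, mul_sum, sum_filter]
    refine sum_congr rfl fun B _ => ?_
    split_ifs with hB
    · rw [hB, mul_one]
    · rfl
  simp_rw [h]
  rw [sum_comm]
  refine sum_congr rfl fun B hB => ?_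
  have h1 := hpos B hB
  have h2 := hle B hB
  rw [sum_eq_single (⟨B.card - 1, by omega⟩ : Fin n)]
  · rw [if_pos (by simp only []; omega)]
  · intro j _ hj
    refine if_neg fun h => hj (Fin.ext ?_)
    simp only [h]
    omega
  · simp

theorem partLength_partitionType (P : Finpartition (univ : Finset (Fin n))) :
    partLength (partitionType P) = P.parts.card := by
  simpa [partLength] using sum_partitionType P fun _ => 1

theorem partitionType_mem (P : Finpartition (univ : Finset (Fin n))) :
    partitionType P ∈ partitionTypes n := by
  rw [mem_partitionTypes]
  have h := sum_partitionType P id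
  simp only [id] at h
  rw [h, P.sum_card_parts]
  simp

/-- Summability allows splitting the sum over the finitely many fibre partitions. The sum over one
fibre depends only on the number of blocks, hence only on the type. -/
theorem tsum_prod_image_eq (s : N → ℝ)
    (hs : Summable fun t : Fin n → N => ∏ η ∈ univ.image t, s η) :
    ∑' t : Fin n → N, ∏ η ∈ univ.image t, s η =
      ∑ τ ∈ partitionTypes n, (partCount τ : ℝ) *
        ∑' e : Fin (partLength τ) ↪ N, ∏ m, s (e m) := by
  have h0 := (Equiv.sigmaFiberEquiv (kerPartition : (Fin n → N) → _)).summable_iff.2 hs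
  rw [← (Equiv.sigmaFiberEquiv (kerPartition : (Fin n → N) → _)).tsum_eq]
  refine h0.tsum_sigma.trans ?_
  rw [tsum_fintype]
  have h1 : ∀ P : Finpartition (univ : Finset (Fin n)),
      ∑' t : {t : Fin n → N // kerPartition t = P}, ∏ η ∈ univ.image t.1, s η =
      ∑' e : Fin (partLength (partitionType P)) ↪ N, ∏ m, s (e m) := by
    intro P
    rw [tsum_kerPartition_fiber, partLength_partitionType]
  refine (sum_congr rfl fun P _ => h1 P).trans ?_
  rw [← sum_fiberwise_of_maps_to (fun P _ => partitionType_mem P)]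
  refine sum_congr rfl fun τ _ => ?_
  rw [sum_congr rfl (g := fun _ => ∑' e : Fin (partLength τ) ↪ N, ∏ m, s (e m)) fun P hP => by
    rw [(mem_filter.1 hP).2], sum_const, nsmul_eq_mul]
  congr 2
  rw [partCount, Nat.card_eq_fintype_card, Fintype.card_subtype]
  congr 1
  ext P
  simp [partitionType, funext_iff]

/-- Composition with a surjection from `Fin n` realizes the family as a subfamily of the summable
family over all tuples, the image of a tuple being unchanged. -/
theorem summable_embedding (hn : 0 < n) {τ : Fin n → ℕ} (hτ : τ ∈ partitionTypes n) (s : N → ℝ)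
    (hs : Summable fun t : Fin n → N => ∏ η ∈ univ.image t, s η) :
    Summable fun e : Fin (partLength τ) ↪ N => ∏ m, s (e m) := by
  rw [mem_partitionTypes] at hτ
  have hle : partLength τ ≤ n := by
    exact (sum_le_sum fun j _ => Nat.le_mul_of_pos_left _ (Nat.succ_pos _)).trans hτ.le
  have hpos : 0 < partLength τ := by
    by_contra h
    have h0 : ∀ j, τ j = 0 := fun j =>
      (sum_eq_zero_iff.1 (Nat.eq_zero_of_not_pos h) j (mem_univ j))
    simp only [h0, mul_zero, sum_const_zero] at hτ
    omega
  -- The surjection truncates indices at the last one; it exists because `0 < partLength τ ≤ n`.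
  let π : Fin n → Fin (partLength τ) := fun i =>
    ⟨min i (partLength τ - 1), by omega⟩
  have hπ : Function.Surjective π := fun m =>
    ⟨⟨m, m.2.trans_le hle⟩, Fin.ext (by have := m.2; simp only [π]; omega)⟩
  have hinj : Function.Injective fun e : Fin (partLength τ) ↪ N => e ∘ π := fun e e' h =>
    DFunLike.coe_injective (hπ.injective_comp_right h)
  refine (hs.comp_injective hinj).congr fun e => ?_
  have h : univ.image (e ∘ π) = univ.image e := by
    rw [← image_image, image_univ_of_surjective hπ]
  simp only [Function.comp_apply]
  change ∏ η ∈ univ.image (e ∘ π), s η = _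
  rw [h, prod_image fun _ _ _ _ h => e.injective h]

end Regrouping

end LocalToGlobal

theorem theorem3p5 {K : Type*} [Field K] [NumberField K] (d n : ℕ) (hd : 0 < d) (hn : 0 < n)
    (E : IntegralBasis K) (U : System K d)
    (hU : ∀ 𝔭 : Primes K, localHaar d 𝔭 (frontier (U.atPrime 𝔭)) = 0)
    (hUinf : nuInftyPi K d (frontier U.atInfty) = 0)
    (hcone : Set.Ici (0 : ℝ) • U.atInfty = U.atInfty)
    (htail : Tendsto (fun M : ℕ => upperDensity E (U.tailSet M)) atTop (𝓝 0))
    (α : ℝ≥0∞) (c' c : ℤ)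
    (hlarge : ∀ H : ℕ, 1 ≤ H → ∀ A ∈ U.goodBox E H,
      (({𝔭 : Primes K | threshold c' α H < (primeBelow 𝔭 : EReal) ∧
        A ∈ U.globalSet (some 𝔭)}.ncard : ℕ) : ℤ) < c)
    (v : Primes K → ℝ)
    (hsmall : ∀ H : ℕ, 1 ≤ H → ∀ 𝔭 : Fin n → Primes K,
      (∀ j, (primeBelow (𝔭 j) : EReal) ≤ threshold c' α H) →
      (((⋂ j, U.globalSet (some (𝔭 j))) ∩ U.goodBox E H).ncard : ℝ) ≤
        (2 * (H : ℝ)) ^ (Module.finrank ℚ K * d) * ∏ j, v (𝔭 j))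
    (hv : Summable v) :
    (∀ τ ∈ partitionTypes n,
      Summable fun η : Fin (partLength τ) ↪ Places K => ∏ m, U.s E (η m)) ∧
    Tendsto (fun H : ℕ => U.momentAverage E n H) atTop
      (𝓝 (∑ τ ∈ partitionTypes n, (partCount τ : ℝ) *
        ∑' η : Fin (partLength τ) ↪ Places K, ∏ m, U.s E (η m))) := by
  classical
  have hs : ∀ η, 0 ≤ U.s E η := by
    rintro (_ | 𝔭)
    · exact mul_nonneg (by positivity) ENNReal.toReal_nonneg
    · exact ENNReal.toReal_nonneg
  obtain ⟨hsum, hlim⟩ := summable_and_tendsto_moment n U.globalSet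
    (fun H => (U.goodBox_finite E H).toFinset)
    (fun H => (2 * (H : ℝ)) ^ (Module.finrank ℚ K * d))
    (by
      filter_upwards [eventually_gt_atTop 0] with H hH
      have : (0 : ℝ) < H := by exact_mod_cast hH
      positivity)
    (U.s E) hs
    (fun F => by
      simpa only [Set.Finite.coe_toFinset] using
        tendsto_ncard_goodBox_inter E U hU hUinf hcone htail F)
    (fun H A hA => Set.not_infinite.1 ((Set.Finite.mem_toFinset _).1 hA).2)
    (fun ε hε => exists_finset_tail_le E U hn htail (threshold c' α) c hlarge v hsmall hv hε)
  refine ⟨fun τ hτ => summable_embedding hn hτ _ hsum, ?_⟩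
  rw [← tsum_prod_image_eq _ hsum]
  exact hlim
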